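/- \textbf{Setting.} Let $C$ be an algebraically closed field of characteristic zero, $n\ge 0$, and let $K_0\subset K_1\subset\cdots\subset K_n$ be a tower of differential fields, where $K_0=C(t_0)$ is the field of rational functions over $C$ with the usual derivation ($c'=0$ for $c\in C$, $t_0'=1$), and $K_i=K_{i-1}(t_i)$ for $1\le i\le n$, where $t_i$ is a \emph{primitive monomial} over $K_{i-1}$, that is, $t_i'\in K_{i-1}$, $t_i$ is transcendental over $K_{i-1}$, and $K_{i-1}(t_i)$ has the same constants as $K_{i-1}$. Put $K_{-1}=C$. Assume that for $1\le i\le n$ the element $t_i$ is a $C$-linear combination of \emph{logarithmic monomials} over $K_{i-1}$ (in some differential extension field), i.e. of primitive monomials $L$ over $K_{i-1}$ with $L'=a'/a$ for some nonzero $a\in K_{i-1}$. \textbf{Parts of an element.} Let $0\le i\le n$. An element of $K_i=K_{i-1}(t_i)$ is \emph{$t_i$-proper} if, as a fraction in $t_i$ over $K_{i-1}$, its numerator has lower degree than its denominator, and \emph{$t_i$-simple} if moreover its denominator in lowest terms is squarefree. Every $x\in K_i$ is uniquely the sum of a $t_i$-proper element $\operatorname{fp}_{t_i}(x)$ and a polynomial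 $\operatorname{pp}_{t_i}(x)\in K_{i-1}[t_i]$. Write $K_i'=\{a' : a\in K_i\}$. The \emph{Hermitian part} $\operatorname{hp}_{t_i}(x)$ is the unique $t_i$-simple element congruent to $x$ modulo $K_i'+K_{i-1}[t_i]$. Leading coefficients $\operatorname{lc}_{t_i}$ of zero polynomials are $0$. \textbf{Straight case.} The tower is \emph{straight} if $\operatorname{hp}_{t_{i-1}}(t_i')\ne 0$ for $2\le i\le n$. An element $r\in K_{-1}$ is \emph{$t_0$-rigid} if $r=0$. For $m\ge 1$, an element $r\in K_{m-1}$ is \emph{$t_m$-rigid} if $\operatorname{fp}_{t_{m-1}}(r)$ is $t_{m-1}$-simple, $\operatorname{fp}_{t_{m-1}}(r)\ne c\,\operatorname{hp}_{t_{m-1}}(t_m')$ for every nonzero $c\in C$, and $\operatorname{lc}_{t_{m-1}}(\operatorname{pp}_{t_{m-1}}(r))$ is $t_{m-1}$-rigid. A polynomial in $K_{n-1}[t_n]$ is \emph{$t_n$-straight} if its leading coefficient is $t_n$-rigid. \textbf{Flat case.} The tower is \emph{flat} if $t_i'\in K_0$ for $1\le i\le n$. Order monomials in $t_1,\dots,t_n$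 purely lexicographically with $t_1\prec\cdots\prec t_n$; for $q\in K_i[t_{i+1},\dots,t_n]$ let $\operatorname{hc}(q)\in K_i$ be the coefficient of its highest monomial in $t_{i+1},\dots,t_n$ ($\operatorname{hc}(0)=0$). For $q\in K_0[t_1,\dots,t_n]$, the \emph{scale} of $q$ is the least index $s$ such that $t_s$ divides the highest monomial of $q$, and is $n$ if $q\in K_0$. An element of $K_0$ is \emph{$k$-rigid} if it is zero, or it is $t_0$-simple and not a $C$-linear combination of $t_1',\dots,t_k'$. If $n=0$, only the zero polynomial is \emph{$t_0$-flat}. If $n\ge 1$, $p\in K_{n-1}[t_n]$ is \emph{$t_n$-flat} if $p=\sum_{i=0}^{n-1}p_i$ with $p_i\in K_i[t_{i+1},\dots,t_n]$ such that $\operatorname{hc}(p_i)$ is $t_i$-simple for all $i\ge 1$ and $\operatorname{hc}(p_0)$ is $s$-rigid, where $s$ is the scale of $p_0$. \textbf{Theorem.} Let $f,g,p\in K_n$ satisfy $f-(g+p)\in K_n'$, where $g$ is $t_n$-simple and where either the tower is straight and $p\in K_{n-1}[t_n]$ is $t_n$-straight, or the tower is flat and $p\in K_{n-1}[t_n]$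 is $t_n$-flat. Then $f$ is elementarily integrable over $K_n$ (that is, $f=h'$ for some $h$ in a differential field extension $E=K_n(\theta_1,\dots,\theta_m)$ such that each $\theta_i$ is, over $K_n(\theta_1,\dots,\theta_{i-1})$, algebraic, a logarithm ($\theta_i'=b'/b$ with $b\neq 0$) or an exponential ($\theta_i\ne0$, $\theta_i'/\theta_i=b'$)) if and only if $g+p$ is a $C$-linear combination of logarithmic derivatives $a'/a$ of nonzero elements $a\in K_n$. -/

import Mathlib

open scoped Differential

namespace DiffTower

universe u v w

/-! ### Elementary integrability -/

section Elementary

/-- `θ` is elementary over `F`: algebraic, or a logarithm, or an exponential over `F`. -/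
def IsElementaryOver (F : Type u) {E : Type v} [Field F] [Field E] [Differential E] [Algebra F E]
    (θ : E) : Prop :=
  IsAlgebraic F θ ∨
  (∃ b : F, b ≠ 0 ∧ θ′ = (algebraMap F E b)′ / algebraMap F E b) ∨
  (θ ≠ 0 ∧ ∃ b : F, θ′ / θ = (algebraMap F E b)′)

/-- `E = F(θ₀, …, θ_{m-1})` with every `θ_i` elementary over `F(θ₀, …, θ_{i-1})`. -/
def IsElementaryExtension (F : Type u) (E : Type v) [Field F] [Field E] [Differential E]
    [Algebra F E] : Prop :=
  ∃ (m : ℕ) (θ : ℕ → E),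
    (∀ i < m, IsElementaryOver (IntermediateField.adjoin F (θ '' Set.Iio i)) (θ i)) ∧
    IntermediateField.adjoin F (θ '' Set.Iio m) = ⊤

/-- `f` has an antiderivative in some elementary extension of the differential field `F`. -/
def IsElementarilyIntegrable {F : Type v} [Field F] [Differential F] (f : F) : Prop :=
  ∃ (E : Type v) (_ : Field E) (_ : Differential E) (_ : Algebra F E)
    (_ : DifferentialAlgebra F E),
    IsElementaryExtension F E ∧ ∃ h : E, h′ = algebraMap F E f

/-- `x` is a logarithmic derivative in `F`. -/
def IsLogDerivative {F : Type v} [Field F] [Differential F] (x : F) : Prop :=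
  ∃ a : F, a ≠ 0 ∧ x = a′ / a

end Elementary

/-! ### Monomials, fractional and Hermitian parts -/

section Monomial

/-- `x ∈ F(z)` is `z`-simple: it is `A/B` in lowest terms with `deg A < deg B` and `B` squarefree
(as polynomials in `z` over `F`). In particular `x` is `z`-proper, and `0` is `z`-simple. -/
def IsSimple (F : Type u) {E : Type v} [Field F] [Field E] [Algebra F E] (z x : E) : Prop :=
  ∃ A B : Polynomial F, IsCoprime A B ∧ Squarefree B ∧ A.degree < B.degree ∧
    x = Polynomial.aeval z A / Polynomial.aeval z B

variable (F : Type u) {E : Type v} [Field F] [Field E] [Differential E] [Algebra F E]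

/-- `z` is primitive and transcendental over `F`, and `F(z)` has no constants outside `F`. -/
def IsPrimitiveMonomial (z : E) : Prop :=
  z′ ∈ (algebraMap F E).range ∧ Transcendental F z ∧
  ∀ x ∈ IntermediateField.adjoin F {z}, x′ = 0 → x ∈ (algebraMap F E).range

/-- A primitive monomial whose derivative is a logarithmic derivative of an element of `F`. -/
def IsLogMonomial (z : E) : Prop :=
  IsPrimitiveMonomial F z ∧
  ∃ a : F, a ≠ 0 ∧ z′ = (algebraMap F E a)′ / algebraMap F E a

/-- `g` is `z`-simple and `x ≡ g` modulo `F(z)′ + F[z]`. -/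
def IsHermitianPart (z x g : E) : Prop :=
  IsSimple F z g ∧
  ∃ a ∈ IntermediateField.adjoin F {z}, ∃ P : Polynomial F, x - g = a′ + Polynomial.aeval z P

open Classical in
/-- The Hermitian part `hp_z(x)` of `x ∈ F(z)`. If `z` is a primitive monomial over the
differential field `F`, it is the unique `g` with `IsHermitianPart F z x g`. -/
noncomputable def hermitianPart (z x : E) : E :=
  if h : ∃ g, IsHermitianPart F z x g then h.choose else 0

end Monomial

/-! ### Towers

A sequence `t : ℕ → K` gives the fields `tfield C t m = C(t₀, …, t_{m-1})`. The field usually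
called `K_i = C(t₀, …, t_i)` is `tfield C t (i + 1)`, and `K_{-1} = C` is `tfield C t 0`;
thus `t m` is adjoined to `tfield C t m`. In a tower of length `n` only `t 0, …, t n` matter. -/

section Tower

variable (C : Type u) {K : Type v} [Field C] [Field K] [Algebra C K]

/-- `C(t₀, …, t_{m-1})`. -/
def tfield (t : ℕ → K) (m : ℕ) : IntermediateField C K :=
  IntermediateField.adjoin C (t '' Set.Iio m)

variable [Differential K]

/-- `K = K_n`, where `K_0 = C(t₀)` is the field of rational functions with the usual derivation
`d/dt₀`, and `K_i = K_{i-1}(t_i)` with `t_i` a primitive monomial over `K_{i-1}`, `1 ≤ i ≤ n`. -/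
structure IsPrimitiveTower (n : ℕ) (t : ℕ → K) : Prop where
  deriv_const : ∀ c : C, (algebraMap C K c)′ = 0
  transcendental_zero : Transcendental C (t 0)
  deriv_zero : (t 0)′ = 1
  monomial : ∀ i, 1 ≤ i → i ≤ n → IsPrimitiveMonomial (tfield C t i) (t i)
  top : tfield C t (n + 1) = ⊤

/-- `hp_{t_{i-1}}(t_i′) ≠ 0` for `2 ≤ i ≤ n` (with `i = j + 1`). -/
def IsStraightTower (n : ℕ) (t : ℕ → K) : Prop :=
  ∀ j, 1 ≤ j → j + 1 ≤ n → hermitianPart (tfield C t j) (t j) (t (j + 1))′ ≠ 0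

/-- `t_i′ ∈ K_0` for `1 ≤ i ≤ n`. -/
def IsFlatTower (n : ℕ) (t : ℕ → K) : Prop :=
  ∀ i, 1 ≤ i → i ≤ n → (t i)′ ∈ tfield C t 1

/-- In some differential extension field, `z` is a `C`-linear combination of logarithmic
monomials over `F`. -/
def IsCombOfLogMonomials (F : IntermediateField C K) (z : K) : Prop :=
  ∃ (E : Type v) (_ : Field E) (_ : Differential E) (_ : Algebra K E)
    (_ : DifferentialAlgebra K E) (m : ℕ) (c : Fin m → C) (L : Fin m → E),
    (∀ j, IsLogMonomial F (L j)) ∧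
    algebraMap K E z = ∑ j, algebraMap K E (algebraMap C K (c j)) * L j

/-! ### Straight polynomials -/

/-- `r ∈ K_{n-1}` is `t_n`-rigid. In the successor case, `f` is the fractional part and `P` the
polynomial part of `r` with respect to `t_n`, and `r` is tested for being `t_{n+1}`-rigid. -/
def IsRigid (t : ℕ → K) : ℕ → K → Prop
  | 0, r => r = 0
  | n + 1, r => ∃ (f : K) (P : Polynomial (tfield C t n)),
      r = f + Polynomial.aeval (t n) P ∧ IsSimple (tfield C t n) (t n) f ∧
      (∀ c : C, c ≠ 0 → f ≠ c • hermitianPart (tfield C t n) (t n) (t (n + 1))′) ∧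
      IsRigid t n (algebraMap (tfield C t n) K P.leadingCoeff)

/-- `p ∈ K_{n-1}[t_n]` is `t_n`-straight: its leading coefficient is `t_n`-rigid. -/
def IsStraightPoly (t : ℕ → K) (n : ℕ) (p : K) : Prop :=
  ∃ P : Polynomial (tfield C t n), p = Polynomial.aeval (t n) P ∧
    IsRigid C t n (algebraMap (tfield C t n) K P.leadingCoeff)

/-! ### Flat polynomials

Variables are indexed by `ℕᵒᵈ`, so that `MonomialOrder.lex` is the purely lexicographic order
with `t_1 ≺ t_2 ≺ ⋯`. -/

/-- The head coefficient (`0` for the zero polynomial). -/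
noncomputable def headCoeff {F : Type v} [Field F] (P : MvPolynomial ℕᵒᵈ F) : F :=
  (MonomialOrder.lex (σ := ℕᵒᵈ)).leadingCoeff P

/-- The scale of `P` with respect to `n`: the least index occurring in the head monomial of `P`,
and `n` if the head monomial is `1` or if `P = 0`. -/
noncomputable def scale {F : Type v} [Field F] (n : ℕ) (P : MvPolynomial ℕᵒᵈ F) : ℕ :=
  if (MonomialOrder.lex (σ := ℕᵒᵈ)).degree P = 0 then n
  else sInf {j : ℕ | (MonomialOrder.lex (σ := ℕᵒᵈ)).degree P (OrderDual.toDual j) ≠ 0}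

/-- `r ∈ K_0` is `k`-rigid: it is zero, or it is `t_0`-simple and not a `C`-linear combination of
`t_1′, …, t_k′`. -/
def IsFlatRigid (t : ℕ → K) (k : ℕ) (r : K) : Prop :=
  r = 0 ∨ (IsSimple (tfield C t 0) (t 0) r ∧
    r ∉ Submodule.span C ((fun j => (t j)′) '' Set.Icc 1 k))

/-- `p ∈ K_{n-1}[t_n]` is `t_n`-flat: `p = 0` if `n = 0`; if `n ≥ 1`, then `p = p_0 + ⋯ + p_{n-1}`
with `p_i ∈ K_i[t_{i+1}, …, t_n]` (here `P i`), such that the head coefficient of `p_i` is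
`t_i`-simple for `i ≥ 1`, and the head coefficient of `p_0` is `s`-rigid with `s` the scale of
`p_0` with respect to `n`. -/
def IsFlatPoly (t : ℕ → K) : ℕ → K → Prop
  | 0, p => p = 0
  | m + 1, p => ∃ P : (i : ℕ) → MvPolynomial ℕᵒᵈ (tfield C t (i + 1)),
      (∀ i ≤ m, ∀ j ∈ (P i).vars, i + 1 ≤ OrderDual.ofDual j ∧ OrderDual.ofDual j ≤ m + 1) ∧
      p = ∑ i ∈ Finset.range (m + 1),
        MvPolynomial.aeval (fun j : ℕᵒᵈ => t (OrderDual.ofDual j)) (P i) ∧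
      (∀ i, 1 ≤ i → i ≤ m →
        IsSimple (tfield C t i) (t i) (algebraMap (tfield C t (i + 1)) K (headCoeff (P i)))) ∧
      IsFlatRigid C t (scale (m + 1) (P 0)) (algebraMap (tfield C t 1) K (headCoeff (P 0)))

end Tower

end DiffTower

/-! Sufficiency is elementary: adjoining logarithms of the finitely many `a` involved yields an
antiderivative (`isElementarilyIntegrable_of_mem_logSpan`).

For necessity, Liouville's theorem (`liouville`) turns an elementary antiderivative of `f` into an
identity `g + p = h′ + x` with `h ∈ K` and `x` a `C`-combination of logarithmic derivatives from
`K`. Its proof adjoins all constants of the elementary extension to `K`, removes the generators one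
at a time from the top (`liouville_step`), and specializes the surviving constants to the
algebraically closed field `C` (`exists_specialization`).

It remains to show that `g + p` itself is such a combination. The tool is Hermite reduction over one
primitive monomial `t` (`hermite_reduction`). A nonzero proper fraction never has a simple
derivative, because differentiation raises the order of each pole. Hence `g` is the simple part of
`x`, which is again a combination of logarithmic derivatives, and polynomial parts satisfy `P = H′ +
y` with `H` a polynomial and `y` a combination of logarithmic derivatives from the field below.

Straight case: comparing leading coefficients gives `lc P = w′ + c t′`, plus `y` if `P` has degree
`0`. In positive degree rigidity forces `lc P = 0` (`IsRigid.eq_zero`), which is absurd. So `p` lies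
in the field below, where it is again a simple element plus a straight polynomial; `c t′` joins the
logarithmic derivatives, and induction applies.

Flat case: as all `t_j′` lie in `K_0`, the coefficient of a monomial in `H′` involves only the
coefficients of `H` at that monomial and at higher ones, so coefficients are compared from the
highest monomial down. For `i ≥ 1` this makes `p_i` a simple combination of logarithmic derivatives
(`mem_logSpan_of_isSimple_headCoeff`). For nonzero `p_0` it makes the head coefficient a combination
of `t_1′, …, t_s′` unless the head monomial is `1`, and `s`-rigidity excludes the former
(`mem_logSpan_of_isFlatRigid`). -/

namespace DiffTower
open Polynomial Differential IntermediateField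

/-! ### Spans of logarithmic derivatives -/

section LogSpan

variable (C : Type*) {E : Type*} [Field C] [Field E] [Differential E] [Algebra C E]

/-- The `C`-span of the logarithmic derivatives of the nonzero elements of `S`. -/
def logSpan (S : Set E) : Submodule C E :=
  Submodule.span C {x | ∃ a ∈ S, a ≠ 0 ∧ x = a′ / a}

variable {C}

lemma logSpan_mono {S T : Set E} (h : S ⊆ T) : logSpan C S ≤ logSpan C T :=
  Submodule.span_mono fun _ ⟨a, ha, h0, hx⟩ => ⟨a, h ha, h0, hx⟩

lemma div_mem_logSpan {S : Set E} {a : E} (ha : a ∈ S) (h0 : a ≠ 0) : a′ / a ∈ logSpan C S :=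
  Submodule.subset_span ⟨a, ha, h0, rfl⟩

omit [Differential E] in
lemma algebraMap_smul_of_tower {F : Type*} [Field F] [Algebra F E] [Algebra C F]
    [IsScalarTower C F E] (c : C) (x : F) :
    algebraMap F E (c • x) = c • algebraMap F E x := by
  rw [Algebra.smul_def, map_mul, ← IsScalarTower.algebraMap_apply, ← Algebra.smul_def]

lemma algebraMap_mem_logSpan {F : Type*} [Field F] [Differential F] [Algebra F E]
    [DifferentialAlgebra F E] [Algebra C F] [IsScalarTower C F E] {S : Set F} {T : Set E}
    (hST : ∀ a ∈ S, algebraMap F E a ∈ T) {y : F} (hy : y ∈ logSpan C S) :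
    algebraMap F E y ∈ logSpan C T := by
  induction hy using Submodule.span_induction with
  | mem x hx =>
    obtain ⟨a, ha, h0, rfl⟩ := hx
    rw [map_div₀, ← deriv_algebraMap]
    exact div_mem_logSpan (hST a ha) ((_root_.map_ne_zero _).2 h0)
  | zero => simp
  | add x y _ _ hx hy => rw [map_add]; exact add_mem hx hy
  | smul c x _ hx =>
    rw [algebraMap_smul_of_tower]
    exact Submodule.smul_mem _ _ hx

lemma deriv_smul (hC : ∀ c : C, (algebraMap C E c)′ = 0) (c : C) (x : E) :
    (c • x)′ = c • x′ := by
  rw [Algebra.smul_def, Algebra.smul_def, Derivation.leibniz, hC]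
  simp

end LogSpan

/-- `x = A(t)/B(t)` with `deg A < deg B`. -/
def IsProper (F : Type*) {E : Type*} [Field F] [Field E] [Algebra F E] (t x : E) : Prop :=
  ∃ A B : F[X], B ≠ 0 ∧ A.degree < B.degree ∧ x = aeval t A / aeval t B

/-! ### Proper and simple fractions in a transcendental element -/

section Proper

variable {F E : Type*} [Field F] [Field E] [Algebra F E] {t : E}

lemma IsSimple.isProper {x : E} (h : IsSimple F t x) : IsProper F t x := by
  obtain ⟨A, B, -, hB, hd, rfl⟩ := h
  exact ⟨A, B, hB.ne_zero, hd, rfl⟩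

lemma exists_isCoprime_div_eq (ht : Transcendental F t) {A B : F[X]} (hB : B ≠ 0)
    (hd : A.degree < B.degree) : ∃ A' B' : F[X], IsCoprime A' B' ∧ B' ∣ B ∧ A'.degree < B'.degree ∧
      aeval t A / aeval t B = aeval t A' / aeval t B' := by
  classical
  obtain ⟨A', hA'⟩ := EuclideanDomain.gcd_dvd_left A B
  obtain ⟨B', hB'⟩ := EuclideanDomain.gcd_dvd_right A B
  have hg := EuclideanDomain.gcd_eq_gcd_ab A B
  set g := EuclideanDomain.gcd A B
  have hg0 : g ≠ 0 := by
    intro h; rw [h, zero_mul] at hB'; exact hB hB'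
  have hgt : aeval t g ≠ 0 := fun h => hg0 ((transcendental_iff.1 ht) g h)
  refine ⟨A', B', ⟨EuclideanDomain.gcdA A B, EuclideanDomain.gcdB A B, ?_⟩, ⟨g, ?_⟩, ?_, ?_⟩
  · refine mul_left_cancel₀ hg0 ?_
    linear_combination -hg - EuclideanDomain.gcdA A B * hA' - EuclideanDomain.gcdB A B * hB'
  · rw [mul_comm]; exact hB'
  · rw [hA', hB', degree_mul, degree_mul] at hd
    exact lt_of_add_lt_add_left hd
  · rw [hA', hB', map_mul, map_mul, mul_div_mul_left _ _ hgt]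

lemma isSimple_of_squarefree (ht : Transcendental F t) {A B : F[X]} (hB : Squarefree B)
    (hd : A.degree < B.degree) : IsSimple F t (aeval t A / aeval t B) := by
  obtain ⟨A', B', h1, h2, h3, h4⟩ := exists_isCoprime_div_eq ht hB.ne_zero hd
  exact ⟨A', B', h1, hB.squarefree_of_dvd h2, h3, h4⟩

lemma isProper_zero : IsProper F t (0 : E) := ⟨0, 1, one_ne_zero, by simp, by simp⟩

lemma isSimple_zero : IsSimple F t (0 : E) :=
  ⟨0, 1, isCoprime_one_right, squarefree_one, by simp, by simp⟩

variable (ht : Transcendental F t)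
include ht

lemma IsSimple.algebraMap_mul {x : E} (c : F) (hx : IsSimple F t x) :
    IsSimple F t (algebraMap F E c * x) := by
  obtain ⟨A, B, -, hB, hd, rfl⟩ := hx
  have : algebraMap F E c * (aeval t A / aeval t B) = aeval t (C c * A) / aeval t B := by
    simp [mul_div_assoc]
  rw [this]
  exact isSimple_of_squarefree ht hB (lt_of_le_of_lt (by rw [← smul_eq_C_mul]; exact degree_smul_le _ _) hd)

lemma aeval_ne_zero {P : F[X]} (hP : P ≠ 0) : aeval t P ≠ 0 := fun h =>
  hP ((transcendental_iff.1 ht) P h)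

lemma IsProper.add {x y : E} (hx : IsProper F t x) (hy : IsProper F t y) :
    IsProper F t (x + y) := by
  obtain ⟨A, B, hB, hd, rfl⟩ := hx
  obtain ⟨A', B', hB', hd', rfl⟩ := hy
  refine ⟨A * B' + B * A', B * B', mul_ne_zero hB hB', ?_, ?_⟩
  · refine lt_of_le_of_lt (degree_add_le _ _) (max_lt ?_ ?_)
    · rw [degree_mul, degree_mul]
      exact WithBot.add_lt_add_right (by simpa [degree_eq_bot] using hB') hd
    · rw [degree_mul, degree_mul]
      exact WithBot.add_lt_add_left (by simpa [degree_eq_bot] using hB) hd'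
  · rw [div_add_div _ _ (aeval_ne_zero ht hB) (aeval_ne_zero ht hB')]
    simp

/-- The radical of `B * B'` is a squarefree common denominator, being divisible by both squarefree
polynomials `B` and `B'`. -/
lemma IsSimple.add {x y : E} (hx : IsSimple F t x) (hy : IsSimple F t y) :
    IsSimple F t (x + y) := by
  classical
  obtain ⟨A, B, -, hB, hd, rfl⟩ := hx
  obtain ⟨A', B', -, hB', hd', rfl⟩ := hy
  have hB0 := hB.ne_zero
  have hB0' := hB'.ne_zero
  have hL0 : B * B' ≠ 0 := mul_ne_zero hB0 hB0'
  have hL : Squarefree (UniqueFactorizationMonoid.radical (B * B')) :=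
    UniqueFactorizationMonoid.squarefree_radical
  have hdvd : ∀ {D : F[X]}, Squarefree D → D ∣ B * B' →
      D ∣ UniqueFactorizationMonoid.radical (B * B') := fun {D} h1 h2 =>
    (UniqueFactorizationMonoid.dvd_radical_iff h1.isRadical hL0).2 h2
  obtain ⟨M, hM⟩ := hdvd hB (dvd_mul_right _ _)
  obtain ⟨M', hM'⟩ := hdvd hB' (dvd_mul_left _ _)
  set R := UniqueFactorizationMonoid.radical (B * B')
  have hM0 : M ≠ 0 := by rintro rfl; exact hL.ne_zero (by simpa using hM)
  have hM0' : M' ≠ 0 := by rintro rfl; exact hL.ne_zero (by simpa using hM')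
  have e : aeval t A / aeval t B + aeval t A' / aeval t B' = aeval t (A * M + A' * M') / aeval t R := by
    have e1 : aeval t A / aeval t B = aeval t (A * M) / aeval t R := by
      rw [hM, map_mul, map_mul, mul_div_mul_right _ _ (aeval_ne_zero ht hM0)]
    have e2 : aeval t A' / aeval t B' = aeval t (A' * M') / aeval t R := by
      rw [hM', map_mul, map_mul, mul_div_mul_right _ _ (aeval_ne_zero ht hM0')]
    rw [e1, e2, map_add, add_div]
  rw [e]
  refine isSimple_of_squarefree ht hL (lt_of_le_of_lt (degree_add_le _ _) (max_lt ?_ ?_))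
  · rw [hM, degree_mul, degree_mul]
    exact WithBot.add_lt_add_right (by simpa [degree_eq_bot] using hM0) hd
  · rw [hM', degree_mul, degree_mul]
    exact WithBot.add_lt_add_right (by simpa [degree_eq_bot] using hM0') hd'

lemma IsProper.eq_zero_of_eq_aeval {x : E} (hx : IsProper F t x) {P : F[X]}
    (hP : x = aeval t P) : P = 0 := by
  obtain ⟨A, B, hB, hd, rfl⟩ := hx
  by_contra h0
  rw [div_eq_iff (aeval_ne_zero ht hB), ← map_mul] at hP
  have := (transcendental_iff_injective.1 ht) hP
  rw [this, degree_mul, degree_eq_natDegree h0, degree_eq_natDegree hB] at hd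
  norm_cast at hd
  omega

lemma exists_isProper_add_aeval {x : E} (hx : x ∈ F⟮t⟯) :
    ∃ (u : E) (Q : F[X]), IsProper F t u ∧ x = u + aeval t Q := by
  obtain ⟨A, B, rfl⟩ := (mem_adjoin_simple_iff F x).1 hx
  by_cases hB : B = 0
  · exact ⟨0, 0, isProper_zero, by simp [hB]⟩
  refine ⟨_, A / B, ⟨A % B, B, hB, EuclideanDomain.mod_lt A hB, rfl⟩, ?_⟩
  have := aeval_ne_zero ht hB
  field_simp
  rw [← map_mul, ← map_add, EuclideanDomain.mod_add_div]

end Proper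

/-! ### Derivations of polynomials in a primitive monomial -/

section PrimitiveMonomial

variable {F : Type*} {E : Type*} [Field F] [Differential F] [Field E] [Differential E]
  [Algebra F E] [DifferentialAlgebra F E]

/-- `t` is transcendental over `F`, and `t′ = η` lies in `F` but is no derivative in `F`. -/
structure IsPrimitiveWith (η : F) (t : E) : Prop where
  deriv_eq : t′ = algebraMap F E η
  transcendental : Transcendental F t
  not_deriv : ∀ w : F, w′ ≠ η

lemma coeff_implicitDeriv_C (η : F) (P : F[X]) (k : ℕ) :
    (implicitDeriv (C η) P).coeff k = (P.coeff k)′ + η * (P.coeff (k + 1) * (k + 1)) := by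
  simp [implicitDeriv, coeff_derivative]

lemma natDegree_implicitDeriv_C_le (η : F) (P : F[X]) :
    (implicitDeriv (C η) P).natDegree ≤ P.natDegree := by
  refine natDegree_le_iff_coeff_eq_zero.2 fun k hk => ?_
  rw [coeff_implicitDeriv_C, coeff_eq_zero_of_natDegree_lt hk,
    coeff_eq_zero_of_natDegree_lt (by omega : P.natDegree < k + 1)]
  simp

lemma degree_implicitDeriv_C_le (η : F) (P : F[X]) :
    (implicitDeriv (C η) P).degree ≤ P.degree := by
  by_cases hP : P = 0
  · simp [hP]
  rw [degree_eq_natDegree hP]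
  exact natDegree_le_iff_degree_le.1 (natDegree_implicitDeriv_C_le η P)

section NotDeriv

variable [CharZero F] {η : F} (hη : ∀ w : F, w′ ≠ η)
include hη

/-- Differentiation lowers the degree only if the leading coefficient is constant. A drop by two or
more would also kill the next coefficient of the derivative, and that equation exhibits `η` as a
derivative in `F`. -/
lemma natDegree_le_of_natDegree_implicitDeriv_le {P : F[X]} {d : ℕ}
    (hd : (implicitDeriv (C η) P).natDegree ≤ d) :
    P.natDegree ≤ d + 1 ∧ (P.coeff (d + 1))′ = 0 := by
  have key : d < P.natDegree → P.leadingCoeff′ = 0 := by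
    intro h
    have h1 := coeff_eq_zero_of_natDegree_lt (lt_of_le_of_lt hd h)
    rw [coeff_implicitDeriv_C,
      coeff_eq_zero_of_natDegree_lt (by omega : P.natDegree < P.natDegree + 1)] at h1
    simpa using h1
  have hle : P.natDegree ≤ d + 1 := by
    by_contra hlt
    obtain ⟨N, hN⟩ : ∃ N, P.natDegree = N + 1 := ⟨P.natDegree - 1, by omega⟩
    have h0 := key (by omega)
    have h1 := coeff_eq_zero_of_natDegree_lt (p := implicitDeriv (C η) P) (n := N) (by omega)
    rw [coeff_implicitDeriv_C, ← hN, coeff_natDegree] at h1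
    have hl : P.leadingCoeff ≠ 0 := by
      rw [leadingCoeff_ne_zero]; rintro rfl; simp at hN
    have hc : (P.leadingCoeff * ((N : F) + 1))′ = 0 := by
      rw [Derivation.leibniz, h0, map_add]; simp
    have hne : P.leadingCoeff * ((N : F) + 1) ≠ 0 := mul_ne_zero hl (Nat.cast_add_one_ne_zero N)
    refine hη (-(P.coeff N) / (P.leadingCoeff * ((N : F) + 1))) ?_
    rw [Derivation.leibniz_div_const _ _ _ hc, map_neg, eq_neg_of_add_eq_zero_left h1, smul_eq_mul]
    field_simp
  refine ⟨hle, ?_⟩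
  rcases hle.lt_or_eq with h | h
  · rw [coeff_eq_zero_of_natDegree_lt h, map_zero]
  · rw [← h]; exact key (by omega)

lemma natDegree_eq_zero_of_implicitDeriv_eq_zero {P : F[X]} (hP : implicitDeriv (C η) P = 0) :
    P.natDegree = 0 := by
  obtain ⟨h1, h2⟩ := natDegree_le_of_natDegree_implicitDeriv_le hη (P := P) (d := 0) (by simp [hP])
  have h3 := coeff_implicitDeriv_C η P 0
  rw [hP] at h3
  by_contra h0
  have h4 : P.natDegree = 1 := by omega
  have h5 : P.coeff 1 ≠ 0 := by
    rw [← h4, coeff_natDegree, leadingCoeff_ne_zero]; rintro rfl; simp at h4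
  simp only [zero_add] at h2
  refine hη (-(P.coeff 0) / P.coeff 1) ?_
  rw [Derivation.leibniz_div_const _ _ _ h2, map_neg]
  simp only [coeff_zero, zero_add, CharP.cast_eq_zero, mul_one] at h3
  rw [eq_neg_of_add_eq_zero_left h3.symm, smul_eq_mul]
  field_simp

/-- The derivative of a monic polynomial has smaller degree, so divisibility forces it to vanish;
then `p` would be constant. -/
lemma not_dvd_implicitDeriv {p : F[X]} (hp : Irreducible p) (hm : p.Monic) :
    ¬ p ∣ implicitDeriv (C η) p := by
  intro h
  have hlt : (implicitDeriv (C η) p).degree < p.degree := by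
    rw [degree_eq_natDegree hp.ne_zero, degree_lt_iff_coeff_zero]
    intro k hk
    rw [coeff_implicitDeriv_C, coeff_eq_zero_of_natDegree_lt (by omega : p.natDegree < k + 1)]
    rcases hk.eq_or_lt with rfl | hk
    · simp [hm.coeff_natDegree]
    · simp [coeff_eq_zero_of_natDegree_lt hk]
  have h0 := eq_zero_of_dvd_of_degree_lt h hlt
  exact hp.natDegree_pos.ne' (natDegree_eq_zero_of_implicitDeriv_eq_zero hη h0)

end NotDeriv

/-! ### Hermite reduction over a primitive monomial -/

section Hermite

variable {η : F} {t : E}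

lemma IsPrimitiveWith.deriv_aeval (ht : IsPrimitiveWith η t) (P : F[X]) :
    (aeval t P)′ = aeval t (implicitDeriv (C η) P) :=
  deriv_aeval_eq_implicitDeriv t (C η) (by simpa using ht.deriv_eq) P

lemma IsProper.deriv (ht : IsPrimitiveWith η t) {x : E} (hx : IsProper F t x) :
    IsProper F t x′ := by
  obtain ⟨A, B, hB, hd, rfl⟩ := hx
  have hBt := aeval_ne_zero ht.transcendental hB
  have hbot : B.degree ≠ ⊥ := by simpa [degree_eq_bot] using hB
  refine ⟨B * implicitDeriv (C η) A - A * implicitDeriv (C η) B, B ^ 2, pow_ne_zero 2 hB, ?_, ?_⟩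
  · rw [pow_two, degree_mul]
    refine lt_of_le_of_lt (degree_sub_le _ _) (max_lt ?_ ?_)
    · rw [degree_mul]
      exact WithBot.add_lt_add_left hbot (lt_of_le_of_lt (degree_implicitDeriv_C_le η A) hd)
    · rw [degree_mul]
      exact lt_of_le_of_lt (add_le_add_right (degree_implicitDeriv_C_le η B) _)
        (WithBot.add_lt_add_right hbot hd)
  · rw [Derivation.leibniz_div, ht.deriv_aeval, ht.deriv_aeval]
    simp only [map_sub, map_mul, map_pow, smul_eq_mul]
    field_simp

variable [CharZero F]

/-- If an irreducible `p` divides the reduced denominator exactly `k + 1` times, then `x′` has a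
pole of order `k + 2 ≥ 2` along `p`, since `p` divides neither its own derivative nor, in
characteristic zero, the factor `k + 1`. A squarefree denominator excludes this. -/
lemma IsProper.eq_zero_of_isSimple_deriv (ht : IsPrimitiveWith η t) {x : E}
    (hx : IsProper F t x) (hx' : IsSimple F t x′) : x = 0 := by
  obtain ⟨A₀, B₀, hB₀, hd₀, rfl⟩ := hx
  obtain ⟨A, B, hcop, hdvd, hd, e⟩ := exists_isCoprime_div_eq ht.transcendental hB₀ hd₀
  rw [e] at hx' ⊢
  have hB : B ≠ 0 := fun h => hB₀ (by simpa [h] using hdvd)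
  by_cases hu : IsUnit B
  · have : A = 0 := by
      rw [degree_eq_zero_of_isUnit hu] at hd
      exact degree_eq_bot.1 (Nat.WithBot.lt_zero_iff.1 hd)
    simp [this]
  exfalso
  obtain ⟨p, hpm, hp, hpB⟩ := exists_monic_irreducible_factor B hu
  obtain ⟨Q, hQ, hpQ⟩ :=
    (FiniteMultiplicity.of_not_isUnit hp.not_isUnit hB).exists_eq_pow_mul_and_not_dvd
  obtain ⟨k, hk⟩ : ∃ k, multiplicity p B = k + 1 := by
    refine Nat.exists_eq_succ_of_ne_zero fun h => ?_
    rw [h, pow_zero, one_mul] at hQ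
    exact hpQ (hQ ▸ hpB)
  rw [hk] at hQ
  have hpA : ¬ p ∣ A := fun h => hp.not_isUnit (hcop.isUnit_of_dvd' h hpB)
  obtain ⟨S, T, -, hT, -, e'⟩ := hx'
  have hBt := aeval_ne_zero ht.transcendental hB
  have hTt := aeval_ne_zero ht.transcendental hT.ne_zero
  set D := implicitDeriv (C η) with hD
  have hmain : (B * D A - A * D B) * T = S * B ^ 2 := by
    apply (transcendental_iff_injective.1 ht.transcendental)
    rw [Derivation.leibniz_div, ht.deriv_aeval, ht.deriv_aeval] at e'
    simp only [map_sub, map_mul, map_pow, smul_eq_mul] at e' ⊢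
    field_simp at e'
    linear_combination e'
  have hDB : D B = p ^ k * ((k + 1 : F[X]) * D p * Q + p * D Q) := by
    rw [hQ, Derivation.leibniz, Derivation.leibniz_pow]
    simp only [smul_eq_mul, nsmul_eq_mul, Nat.add_sub_cancel]
    push_cast
    ring
  have hW : (p * Q * D A - A * ((k + 1 : F[X]) * D p * Q + p * D Q)) * T =
      p ^ 2 * (p ^ k * (S * Q ^ 2)) := by
    refine mul_left_cancel₀ (pow_ne_zero k hp.ne_zero) ?_
    rw [hDB] at hmain
    rw [hQ] at hmain
    linear_combination hmain
  have hpp : Prime p := hp.prime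
  -- Modulo `p` the bracket is `-(k + 1) * A * D p * Q`, and `p` divides none of these factors.
  have hpW : ¬ p ∣ (p * Q * D A - A * ((k + 1 : F[X]) * D p * Q + p * D Q)) := by
    intro h
    have h1 : p ∣ A * ((k + 1 : F[X]) * D p * Q) := by
      have h2 : p ∣ p * (Q * D A - A * D Q) := dvd_mul_right _ _
      have := dvd_sub h2 h
      convert this using 1
      ring
    rcases hpp.dvd_or_dvd h1 with h1 | h1
    · exact hpA h1
    rcases hpp.dvd_or_dvd h1 with h1 | h1
    · rcases hpp.dvd_or_dvd h1 with h1 | h1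
      · have hu : IsUnit (k + 1 : F[X]) := by
          have : (k + 1 : F[X]) = C (k + 1 : F) := by simp
          rw [this, isUnit_C]
          exact (Nat.cast_add_one_ne_zero k).isUnit
        exact hp.not_isUnit (isUnit_of_dvd_unit h1 hu)
      · exact not_dvd_implicitDeriv ht.not_deriv hp hpm h1
    · exact hpQ h1
  have h2 : p ^ 2 ∣ T := by
    have hc : IsCoprime (p ^ 2) _ := ((hp.coprime_iff_not_dvd).2 hpW).pow_left (m := 2)
    exact hc.dvd_of_dvd_mul_left ⟨_, hW⟩
  exact hp.not_isUnit (hT p (by rwa [← pow_two]))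

omit [CharZero F] in
-- Logarithmic derivatives turn factorizations into sums. A monic irreducible factor `q` contributes
-- `q′/q`, simple because `q′` has smaller degree than `q`; the leading coefficients are collected
-- in `b`.
lemma exists_logDeriv_aeval_eq (ht : IsPrimitiveWith η t) {a : F[X]} (ha : a ≠ 0) :
    ∃ s : E, ∃ b : F, b ≠ 0 ∧ IsSimple F t s ∧
      logDeriv (aeval t a) = s + algebraMap F E (logDeriv b) := by
  induction a using UniqueFactorizationMonoid.induction_on_prime with
  | h₁ => exact absurd rfl ha
  | h₂ a hu =>
    obtain ⟨b, hb, rfl⟩ := Polynomial.isUnit_iff.1 hu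
    exact ⟨0, b, hb.ne_zero, isSimple_zero, by simp [logDeriv_algebraMap]⟩
  | h₃ a p ha0 hp ih =>
    obtain ⟨s, b, hb, hs, e⟩ := ih ha0
    have hl : p.leadingCoeff ≠ 0 := leadingCoeff_ne_zero.2 hp.ne_zero
    set q := p * C p.leadingCoeff⁻¹ with hq
    have hqm : q.Monic := monic_mul_leadingCoeff_inv hp.ne_zero
    have hqi : Irreducible q := irreducible_mul_leadingCoeff_inv.2 hp.irreducible
    have hpq : p = C p.leadingCoeff * q := by
      rw [hq, mul_left_comm, ← C_mul, mul_inv_cancel₀ hl, C_1, mul_one]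
    have hlE : algebraMap F E p.leadingCoeff ≠ 0 := by simpa using hl
    have hqE := aeval_ne_zero ht.transcendental hqm.ne_zero
    have haE := aeval_ne_zero ht.transcendental ha0
    refine ⟨logDeriv (aeval t q) + s, p.leadingCoeff * b, mul_ne_zero hl hb,
      IsSimple.add ht.transcendental ?_ hs, ?_⟩
    · rw [Differential.logDeriv, ht.deriv_aeval]
      refine isSimple_of_squarefree ht.transcendental hqi.squarefree ?_
      refine lt_of_le_of_ne (degree_implicitDeriv_C_le η q) fun h => ?_
      have h1 : (implicitDeriv (C η) q).coeff q.natDegree = 0 := by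
        rw [coeff_implicitDeriv_C,
          coeff_eq_zero_of_natDegree_lt (by omega : q.natDegree < q.natDegree + 1)]
        simp [hqm.coeff_natDegree]
      have h2 := natDegree_eq_of_degree_eq h
      rw [← h2, coeff_natDegree, leadingCoeff_eq_zero] at h1
      rw [h1, degree_zero] at h
      exact hqm.ne_zero (degree_eq_bot.1 h.symm)
    · rw [map_mul, logDeriv_mul _ _ (aeval_ne_zero ht.transcendental hp.ne_zero) haE, e]
      conv_lhs => rw [hpq]
      rw [map_mul, aeval_C, logDeriv_mul _ _ hlE hqE, logDeriv_mul _ _ hl hb, logDeriv_algebraMap,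
        map_add]
      ring

omit [CharZero F] in
lemma exists_logDeriv_eq (ht : IsPrimitiveWith η t) {a : E} (ha : a ∈ F⟮t⟯) (h0 : a ≠ 0) :
    ∃ s : E, ∃ b : F, b ≠ 0 ∧ IsSimple F t s ∧
      a′ / a = s + algebraMap F E (b′ / b) := by
  obtain ⟨A, B, rfl⟩ := (mem_adjoin_simple_iff F a).1 ha
  have hA : A ≠ 0 := by rintro rfl; simp at h0
  have hB : B ≠ 0 := by rintro rfl; simp at h0
  obtain ⟨s, b, hb, hs, e⟩ := exists_logDeriv_aeval_eq ht hA
  obtain ⟨s', b', hb', hs', e'⟩ := exists_logDeriv_aeval_eq ht hB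
  refine ⟨s + algebraMap F E (-1) * s', b / b', div_ne_zero hb hb',
    hs.add ht.transcendental (hs'.algebraMap_mul ht.transcendental _), ?_⟩
  change Differential.logDeriv _ = s + algebraMap F E (-1) * s' +
    algebraMap F E (Differential.logDeriv _)
  rw [logDeriv_div _ _ (aeval_ne_zero ht.transcendental hA) (aeval_ne_zero ht.transcendental hB),
    logDeriv_div _ _ hb hb', e, e']
  simp only [map_neg, map_one, map_sub]
  ring

omit [DifferentialAlgebra F E] in
-- Coefficients are compared in degree `d = deg P`. As `H` has degree at most `d + 1` with constant
-- coefficient there, `w` is its coefficient in degree `d` and `c` is `d + 1` times the next one.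
lemma leadingCoeff_implicitDeriv_add_C (ht : IsPrimitiveWith η t) {P H : F[X]} {y : F}
    (e : P = implicitDeriv (C η) H + C y) : ∃ w c : F, c′ = 0 ∧
      P.leadingCoeff = w′ + c * η + if P.natDegree = 0 then y else 0 := by
  have h1 : implicitDeriv (C η) H = P - C y := by rw [e]; ring
  have h2 : (implicitDeriv (C η) H).natDegree ≤ P.natDegree := by
    rw [h1]; exact (natDegree_sub_C.le)
  obtain ⟨-, h3⟩ := natDegree_le_of_natDegree_implicitDeriv_le ht.not_deriv h2
  refine ⟨H.coeff P.natDegree, H.coeff (P.natDegree + 1) * (P.natDegree + 1), ?_, ?_⟩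
  · rw [Derivation.leibniz, h3, map_add]; simp
  · have h4 := congrArg (fun q => q.coeff P.natDegree) e
    simp only [coeff_natDegree, coeff_add, coeff_implicitDeriv_C, coeff_C] at h4
    rw [h4]; ring

lemma IsPrimitiveWith.mem_range_of_deriv_eq_zero (ht : IsPrimitiveWith η t) {x : E}
    (hx : x ∈ F⟮t⟯) (h0 : x′ = 0) : x ∈ (algebraMap F E).range := by
  obtain ⟨u, Q, hu, rfl⟩ := exists_isProper_add_aeval ht.transcendental hx
  rw [map_add, ht.deriv_aeval] at h0
  have h1 := (hu.deriv ht).eq_zero_of_eq_aeval ht.transcendental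
    (P := -implicitDeriv (C η) Q) (by rw [map_neg]; linear_combination h0)
  rw [neg_eq_zero] at h1
  rw [h1, map_zero, add_zero] at h0
  rw [hu.eq_zero_of_isSimple_deriv ht (h0 ▸ isSimple_zero), zero_add,
    eq_C_of_natDegree_eq_zero (natDegree_eq_zero_of_implicitDeriv_eq_zero ht.not_deriv h1)]
  exact ⟨Q.coeff 0, by simp⟩

omit [CharZero F] [DifferentialAlgebra F E] in
lemma isSimple_neg (ht : IsPrimitiveWith η t) {z : E} (hz : IsSimple F t z) :
    IsSimple F t (-z) := by
  simpa using hz.algebraMap_mul ht.transcendental (-1)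

/-- Split `h` into a proper part `u` and a polynomial. Then `u′ - g` is both proper and polynomial,
so `u′ = g` is simple and `u = 0`. This also underlies the uniqueness of Hermitian parts. -/
lemma eq_zero_of_isSimple_add_aeval_eq_deriv (ht : IsPrimitiveWith η t) {g h : E} {P : F[X]}
    (hg : IsSimple F t g) (hh : h ∈ F⟮t⟯) (e : g + aeval t P = h′) :
    g = 0 ∧ ∃ H : F[X], h = aeval t H ∧ P = implicitDeriv (C η) H := by
  obtain ⟨u, Q, hu, rfl⟩ := exists_isProper_add_aeval ht.transcendental hh
  rw [map_add, ht.deriv_aeval] at e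
  have hprop : IsProper F t (u′ + -g) :=
    (hu.deriv ht).add ht.transcendental (isSimple_neg ht hg).isProper
  have h0 := hprop.eq_zero_of_eq_aeval ht.transcendental
    (P := P - implicitDeriv (C η) Q) (by simp; linear_combination -e)
  rw [sub_eq_zero] at h0
  have h1 : u′ = g := by
    rw [h0] at e
    linear_combination -e
  have hu0 := hu.eq_zero_of_isSimple_deriv ht (h1 ▸ hg)
  rw [hu0, map_zero] at h1
  exact ⟨h1.symm, Q, by rw [hu0, zero_add], h0⟩

variable {k : Type*} [Field k] [Algebra k F] [Algebra k E] [IsScalarTower k F E]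

omit [CharZero F] in
-- Splits a combination of logarithmic derivatives into its simple part and a part from the base
-- field. The simple part is again such a combination, being the difference of two.
lemma exists_isSimple_of_mem_logSpan (ht : IsPrimitiveWith η t) {x : E}
    (hx : x ∈ logSpan k (F⟮t⟯ : Set E)) :
    ∃ s : E, ∃ y ∈ logSpan k (Set.univ : Set F), IsSimple F t s ∧
      s ∈ logSpan k (F⟮t⟯ : Set E) ∧ x = s + algebraMap F E y := by
  have hle : ∀ y ∈ logSpan k (Set.univ : Set F),
      algebraMap F E y ∈ logSpan k (F⟮t⟯ : Set E) := fun y hy =>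
    algebraMap_mem_logSpan (fun a _ => IntermediateField.algebraMap_mem _ a) hy
  induction hx using Submodule.span_induction with
  | mem x hx =>
    obtain ⟨a, ha, h0, rfl⟩ := hx
    obtain ⟨s, b, hb, hs, e⟩ := exists_logDeriv_eq ht ha h0
    refine ⟨s, b′ / b, div_mem_logSpan (Set.mem_univ _) hb, hs, ?_, e⟩
    rw [← sub_eq_iff_eq_add.2 e]
    exact sub_mem (div_mem_logSpan ha h0) (hle _ (div_mem_logSpan (Set.mem_univ _) hb))
  | zero => exact ⟨0, 0, zero_mem _, isSimple_zero, zero_mem _, by simp⟩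
  | add x y _ _ hx hy =>
    obtain ⟨s, z, hz, hs, hs', rfl⟩ := hx
    obtain ⟨s', z', hz', hs₁, hs₁', rfl⟩ := hy
    exact ⟨s + s', z + z', add_mem hz hz', hs.add ht.transcendental hs₁, add_mem hs' hs₁',
      by rw [map_add]; ring⟩
  | smul c x _ hx =>
    obtain ⟨s, z, hz, hs, hs', rfl⟩ := hx
    refine ⟨c • s, c • z, Submodule.smul_mem _ _ hz, ?_, Submodule.smul_mem _ _ hs', ?_⟩
    · rw [← IsScalarTower.algebraMap_smul F c s, Algebra.smul_def]
      exact hs.algebraMap_mul ht.transcendental _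
    · rw [smul_add, algebraMap_smul_of_tower]

/-- Hermite reduction of `g + P(t) = h′ + ∑ cⱼ aⱼ′/aⱼ` in `F(t)`, `g` being `t`-simple. -/
lemma hermite_reduction (ht : IsPrimitiveWith η t) {g h x : E} {P : F[X]} (hg : IsSimple F t g)
    (hh : h ∈ F⟮t⟯) (hx : x ∈ logSpan k (F⟮t⟯ : Set E)) (e : g + aeval t P = h′ + x) :
    g ∈ logSpan k (F⟮t⟯ : Set E) ∧ ∃ H : F[X], ∃ y ∈ logSpan k (Set.univ : Set F),
      P = implicitDeriv (C η) H + C y := by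
  obtain ⟨s, y, hy, hs, hs', rfl⟩ := exists_isSimple_of_mem_logSpan ht hx
  -- Moving `x = s + y` to the left leaves the simple element `g - s` plus the polynomial `P - y`,
  -- equal to a derivative.
  obtain ⟨h0, H, -, hH⟩ := eq_zero_of_isSimple_add_aeval_eq_deriv ht (g := g + -s)
    (P := P - C y) (hg.add ht.transcendental (isSimple_neg ht hs)) hh
    (by simp only [map_sub, aeval_C]; linear_combination e)
  exact ⟨(add_neg_eq_zero.1 h0).symm ▸ hs', H, y, hy, by linear_combination hH⟩

end Hermite

end PrimitiveMonomial
end DiffTower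

namespace DiffTower
open Polynomial Differential IntermediateField

/-! ### The differential structure of the tower -/

section DerivClosed

variable {C K : Type*} [Field C] [Field K] [Differential K] [Algebra C K]

/-- The subfield `F` is closed under the derivation. -/
def DerivClosed (F : IntermediateField C K) : Prop := ∀ x ∈ F, x′ ∈ F

/-- The restriction of the derivation. -/
@[reducible]
def DerivClosed.differential {F : IntermediateField C K} (h : DerivClosed F) : Differential F where
  deriv := Derivation.mk'
    { toFun := fun x => ⟨(x : K)′, h x x.2⟩
      map_add' := fun x y => Subtype.ext (by simp)
      map_smul' := fun m x => Subtype.ext (by simp) } fun a b => Subtype.ext (by simp)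

lemma DerivClosed.differentialAlgebra {F : IntermediateField C K} (h : DerivClosed F) :
    letI := h.differential
    DifferentialAlgebra F K :=
  letI := h.differential
  ⟨fun _ => rfl⟩

lemma derivClosed_adjoin (hC : ∀ c : C, (algebraMap C K c)′ = 0) {S : Set K}
    (hS : ∀ s ∈ S, s′ ∈ adjoin C S) : DerivClosed (adjoin C S) := by
  intro x hx
  induction hx using adjoin_induction with
  | mem x hx => exact hS x hx
  | algebraMap c => rw [hC]; exact zero_mem _
  | add x y _ _ hx hy => rw [map_add]; exact add_mem hx hy
  | inv x hx' hx =>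
    rw [Derivation.leibniz_inv, smul_eq_mul]
    exact mul_mem (neg_mem (pow_mem (inv_mem hx') 2)) hx
  | mul x y hx' hy' hx hy =>
    rw [Derivation.leibniz, smul_eq_mul, smul_eq_mul]
    exact add_mem (mul_mem hx' hy) (mul_mem hy' hx)

end DerivClosed

section Tower

variable {C K : Type*} [Field C] [Field K] [Algebra C K] {t : ℕ → K} {n : ℕ}

lemma mem_tfield_self {i m : ℕ} (h : i < m) : t i ∈ tfield C t m :=
  subset_adjoin _ _ ⟨i, h, rfl⟩

lemma tfield_mono {i m : ℕ} (h : i ≤ m) : tfield C t i ≤ tfield C t m :=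
  adjoin.mono _ _ _ (Set.image_mono (Set.Iio_subset_Iio h))

lemma coe_deriv_eq_zero [Differential K] {F : IntermediateField C K} [Differential F]
    [DifferentialAlgebra F K] {c : F} (hc : c′ = 0) : (c : K)′ = 0 := by
  have := deriv_algebraMap (B := K) c
  rwa [hc, map_zero] at this

lemma restrictScalars_adjoin_tfield (m : ℕ) :
    (adjoin (tfield C t m) {t m}).restrictScalars C = tfield C t (m + 1) := by
  rw [tfield, adjoin_adjoin_left, tfield]
  congr 1
  rw [← Set.image_singleton, ← Set.image_union]
  congr 1
  ext i
  simp only [Set.mem_union, Set.mem_Iio, Set.mem_singleton_iff]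
  omega

lemma mem_adjoin_tfield_iff {m : ℕ} {x : K} :
    x ∈ adjoin (tfield C t m) {t m} ↔ x ∈ tfield C t (m + 1) := by
  rw [← restrictScalars_adjoin_tfield]; rfl

lemma mem_tfield_zero_iff {x : K} : x ∈ tfield C t 0 ↔ ∃ c : C, algebraMap C K c = x := by
  have : tfield C t 0 = ⊥ := by simp [tfield]
  rw [this, mem_bot]; rfl

variable [Differential K]

namespace IsPrimitiveTower

variable (h : IsPrimitiveTower C n t)
include h

lemma deriv_mem {m : ℕ} (hm : m ≤ n) : (t m)′ ∈ tfield C t m := by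
  rcases Nat.eq_zero_or_pos m with rfl | h0
  · rw [h.deriv_zero]; exact one_mem _
  · obtain ⟨η, hη⟩ := (h.monomial m h0 hm).1
    rw [← hη]; exact η.2

lemma derivClosed {m : ℕ} (hm : m ≤ n + 1) : DerivClosed (tfield C t m) := by
  refine derivClosed_adjoin h.deriv_const ?_
  rintro _ ⟨i, hi, rfl⟩
  have hi : i < m := hi
  exact tfield_mono hi.le (h.deriv_mem (by omega))

/-- An antiderivative `w` of `t_m′` in the lower field would make `t_m - w` a constant, hence put
`t_m` into that field. For `m = 0` the lower field is `C`, where all derivatives vanish, while `t_0′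
= 1`. -/
lemma exists_isPrimitiveWith {m : ℕ} (hm : m ≤ n) :
    letI := (h.derivClosed (by omega : m ≤ n + 1)).differential
    ∃ η : tfield C t m, IsPrimitiveWith η (t m) := by
  let _ := (h.derivClosed (by omega : m ≤ n + 1)).differential
  refine ⟨⟨_, h.deriv_mem hm⟩, rfl, ?_, ?_⟩
  · rcases Nat.eq_zero_or_pos m with rfl | h0
    · intro halg
      have : Algebra.IsAlgebraic C (tfield C t 0) :=
        ⟨fun x => by
          obtain ⟨c, hc⟩ := mem_tfield_zero_iff.1 x.2
          have : x = algebraMap C _ c := Subtype.ext hc.symm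
          rw [this]; exact isAlgebraic_algebraMap c⟩
      exact h.transcendental_zero (halg.restrictScalars C)
    · exact (h.monomial m h0 hm).2.1
  · intro w hw
    have hw' : (w : K)′ = (t m)′ := congrArg Subtype.val hw
    rcases Nat.eq_zero_or_pos m with rfl | h0
    · obtain ⟨c, hc⟩ := mem_tfield_zero_iff.1 w.2
      rw [h.deriv_zero, ← hc, h.deriv_const] at hw'
      exact zero_ne_one hw'
    · have hmem : t m - w ∈ adjoin (tfield C t m) {t m} :=
        sub_mem (mem_adjoin_simple_self _ _) (IntermediateField.algebraMap_mem _ w)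
      obtain ⟨z, hz⟩ := (h.monomial m h0 hm).2.2 _ hmem (by rw [map_sub, hw', sub_self])
      refine (h.monomial m h0 hm).2.1 ?_
      have : t m = algebraMap (tfield C t m) K (z + w) := by
        rw [map_add, hz]; exact (sub_add_cancel _ _).symm
      rw [this]; exact isAlgebraic_algebraMap _

variable [CharZero C]

lemma exists_differential {m : ℕ} (hm : m ≤ n) : CharZero (tfield C t m) ∧
    ∃ (_ : Differential (tfield C t m)) (_ : DifferentialAlgebra (tfield C t m) K)
      (η : tfield C t m), IsPrimitiveWith η (t m) :=
  ⟨charZero_of_injective_algebraMap (algebraMap C (tfield C t m)).injective,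
    _, (h.derivClosed (by omega : m ≤ n + 1)).differentialAlgebra, h.exists_isPrimitiveWith hm⟩

lemma exists_eq_of_deriv_eq_zero {m : ℕ} (hm : m ≤ n + 1) {x : K} (hx : x ∈ tfield C t m)
    (h0 : x′ = 0) : ∃ c : C, algebraMap C K c = x := by
  induction m generalizing x with
  | zero => exact mem_tfield_zero_iff.1 hx
  | succ m ih =>
    obtain ⟨_, _, _, η, hη⟩ := h.exists_differential (m := m) (by omega)
    obtain ⟨y, rfl⟩ := hη.mem_range_of_deriv_eq_zero (mem_adjoin_tfield_iff.2 hx) h0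
    exact ih (by omega) y.2 h0

end IsPrimitiveTower

omit [Differential K] in
lemma tfield_subset_iff {m : ℕ} :
    (adjoin (tfield C t m) {t m} : Set K) = (tfield C t (m + 1) : Set K) :=
  Set.ext fun _ => mem_adjoin_tfield_iff

/-- The logarithms live in an extension, but their derivatives `a′/a` come from `F`, so the
differentiated identity can be pulled back to `K`. -/
lemma IsCombOfLogMonomials.deriv_mem_logSpan (hC : ∀ c : C, (algebraMap C K c)′ = 0)
    {F : IntermediateField C K} {z : K} (hz : IsCombOfLogMonomials C F z) :
    z′ ∈ logSpan C (F : Set K) := by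
  obtain ⟨E, _, _, _, _, m, c, L, hL, e⟩ := hz
  choose hL a ha hLa using hL
  have key : z′ = ∑ j, c j • ((algebraMap F K (a j))′ / algebraMap F K (a j)) := by
    apply (algebraMap K E).injective
    rw [← deriv_algebraMap, e, map_sum, map_sum]
    refine Finset.sum_congr rfl fun j _ => ?_
    rw [Derivation.leibniz, deriv_algebraMap, hC, hLa, Algebra.smul_def (c j), _root_.map_mul, map_div₀,
      ← deriv_algebraMap, map_zero, smul_zero, add_zero, smul_eq_mul]
    rfl
  rw [key]
  exact Submodule.sum_mem _ fun j _ => Submodule.smul_mem _ _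
    (div_mem_logSpan (a j).2 (by simpa using ha j))

end Tower

/-! ### The straight case -/

section Straight

variable {C K : Type*} [Field C] [CharZero C] [Field K] [Differential K] [Algebra C K]
  {t : ℕ → K} {n : ℕ}

omit [CharZero C] in
lemma IsHermitianPart.eq {F E : Type*} [Field F] [CharZero F] [Differential F] [Field E]
    [Differential E] [Algebra F E] [DifferentialAlgebra F E] {η : F} {t x g g' : E}
    (ht : IsPrimitiveWith η t) (hg : IsHermitianPart F t x g) (hg' : IsHermitianPart F t x g') :
    g = g' := by
  obtain ⟨hs, a, ha, P, e⟩ := hg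
  obtain ⟨hs', a', ha', P', e'⟩ := hg'
  have h := (eq_zero_of_isSimple_add_aeval_eq_deriv ht (g := g + -g') (P := P - P') (h := a' - a)
    (hs.add ht.transcendental (isSimple_neg ht hs')) (sub_mem ha' ha)
    (by simp only [map_sub]; linear_combination e' - e)).1
  exact add_neg_eq_zero.1 h

omit [CharZero C] in
lemma hermitianPart_eq {F E : Type*} [Field F] [CharZero F] [Differential F] [Field E]
    [Differential E] [Algebra F E] [DifferentialAlgebra F E] {η : F} {t x g : E}
    (ht : IsPrimitiveWith η t) (hg : IsHermitianPart F t x g) : hermitianPart F t x = g := by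
  have h : ∃ g, IsHermitianPart F t x g := ⟨g, hg⟩
  rw [hermitianPart, dif_pos h]
  exact h.choose_spec.eq ht hg

/-- Induction down the tower. If `c = 0`, then `r` is a derivative, so its simple part vanishes and
the leading coefficient of its polynomial part again has the form `c₀ t′ + w′` one level lower. If
`c ≠ 0`, the fractional part of `r` is `c` times the Hermitian part of `t_m′`, which rigidity
forbids. -/
lemma IsRigid.eq_zero (htow : IsPrimitiveTower C n t) {m : ℕ} (hm : m ≤ n) {r h : K} {c : C}
    (hr : IsRigid C t m r) (hh : h ∈ tfield C t m) (e : r = c • (t m)′ + h′) : r = 0 := by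
  induction m generalizing r h c with
  | zero => exact hr
  | succ m ih =>
    obtain ⟨f, P, rfl, hf, hne, hlc⟩ := hr
    obtain ⟨_, _, _, η, ht⟩ := htow.exists_differential (m := m) (by omega)
    have hh' := mem_adjoin_tfield_iff.2 hh
    by_cases hc : c = 0
    · subst hc
      rw [zero_smul, zero_add] at e
      obtain ⟨rfl, H, -, hP⟩ := eq_zero_of_isSimple_add_aeval_eq_deriv ht hf hh' e
      obtain ⟨w, c, hc, hl⟩ := leadingCoeff_implicitDeriv_add_C ht (P := P) (H := H) (y := 0)
        (by rw [hP]; simp)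
      obtain ⟨c₀, hc₀⟩ := htow.exists_eq_of_deriv_eq_zero (by omega : m ≤ n + 1) c.2
        (coe_deriv_eq_zero hc)
      have := ih (by omega) hlc w.2 (c := c₀) (by
        rw [hl, ite_self, add_zero, map_add, map_mul, ← ht.deriv_eq, ← deriv_algebraMap,
          Algebra.smul_def, hc₀, add_comm]; rfl)
      rw [_root_.map_eq_zero, leadingCoeff_eq_zero] at this
      simp [this]
    · exfalso
      refine hne c hc ?_
      have hcK : algebraMap C K c ≠ 0 := by simpa using hc
      have : IsHermitianPart (tfield C t m) (t m) (t (m + 1))′ (c⁻¹ • f) := by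
        refine ⟨?_, c⁻¹ • -h, ?_, c⁻¹ • P, ?_⟩
        · rw [← IsScalarTower.algebraMap_smul (tfield C t m) c⁻¹ f, Algebra.smul_def]
          exact hf.algebraMap_mul ht.transcendental _
        · rw [mem_adjoin_tfield_iff]
          exact IntermediateField.smul_mem _ (neg_mem hh)
        · rw [deriv_smul htow.deriv_const, map_neg,
            ← IsScalarTower.algebraMap_smul (tfield C t m) c⁻¹ P, map_smul,
            IsScalarTower.algebraMap_smul, ← sub_eq_zero, ← smul_right_inj hc]
          simp only [smul_sub, smul_neg, smul_add, smul_inv_smul₀ hc, smul_zero]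
          linear_combination -e
      rw [hermitianPart_eq ht this, smul_inv_smul₀ hc]

/-- Hermite reduction disposes of `g`. Rigidity forces the polynomial into degree `0`, and the same
problem is posed one level lower with a new simple part and a new straight polynomial. -/
lemma mem_logSpan_of_isStraightPoly (htow : IsPrimitiveTower C n t)
    (hlog : ∀ i, 1 ≤ i → i ≤ n → (t i)′ ∈ logSpan C (tfield C t i : Set K))
    {m : ℕ} (hm : m ≤ n) {g p h x : K} (hg : IsSimple (tfield C t m) (t m) g)
    (hp : IsStraightPoly C t m p) (hh : h ∈ tfield C t (m + 1))
    (hx : x ∈ logSpan C (tfield C t (m + 1) : Set K)) (e : g + p = h′ + x) :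
    g + p ∈ logSpan C (Set.univ : Set K) := by
  induction m using Nat.strong_induction_on generalizing g p h x with
  | _ m ih =>
  obtain ⟨P, rfl, hr⟩ := hp
  obtain ⟨_, _, _, η, ht⟩ := htow.exists_differential hm
  rw [← tfield_subset_iff] at hx
  obtain ⟨hgl, H, y, hy, hP⟩ := hermite_reduction ht hg (mem_adjoin_tfield_iff.2 hh) hx e
  obtain ⟨w, c, hc, hl⟩ := leadingCoeff_implicitDeriv_add_C ht hP
  obtain ⟨c₀, hc₀⟩ := htow.exists_eq_of_deriv_eq_zero (by omega : m ≤ n + 1) c.2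
    (coe_deriv_eq_zero hc)
  refine add_mem (logSpan_mono (Set.subset_univ _) hgl) ?_
  have hl' : algebraMap (tfield C t m) K P.leadingCoeff = (w : K)′ +
      (c₀ • (t m)′ + algebraMap (tfield C t m) K (if P.natDegree = 0 then y else 0)) := by
    rw [hl, map_add, map_add, map_mul, ← ht.deriv_eq, ← deriv_algebraMap, Algebra.smul_def, hc₀,
      add_assoc]
    rfl
  by_cases hd : P.natDegree = 0
  · rw [if_pos hd] at hl'
    have hPC : aeval (t m) P = algebraMap (tfield C t m) K P.leadingCoeff := by
      conv_lhs => rw [eq_C_of_natDegree_eq_zero hd]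
      rw [aeval_C, leadingCoeff, hd]
    rw [hPC]
    cases m with
    | zero =>
      have h0 : algebraMap (tfield C t 0) K P.leadingCoeff = 0 := hr
      rw [h0]; exact zero_mem _
    | succ m =>
      obtain ⟨f, Q, hfQ, hf, -, hlc⟩ := hr
      rw [hfQ]
      -- The term `c₀ t_{m+1}′` is a combination of logarithmic derivatives and joins `y`; only `w′`
      -- remains as a derivative.
      refine ih m (by omega) (by omega) hf ⟨Q, rfl, hlc⟩ w.2
        (add_mem (Submodule.smul_mem _ _ (hlog (m + 1) (by omega) hm)) ?_) (hfQ ▸ hl')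
      exact algebraMap_mem_logSpan (fun a _ => a.2) hy
  · rw [if_neg hd, map_zero, add_zero, add_comm] at hl'
    have h0 := hr.eq_zero htow hm w.2 hl'
    rw [_root_.map_eq_zero, leadingCoeff_eq_zero] at h0
    exact absurd (by simp [h0]) hd

end Straight

end DiffTower

namespace DiffTower
open Polynomial Differential IntermediateField

/-! ### Liouville's theorem for one elementary generator without new constants -/

section LiouvilleStep

variable {C F E : Type*} [Field C] [CharZero C] [Field F] [Differential F] [Field E]
  [Differential E] [Algebra F E] [DifferentialAlgebra F E] [Algebra C F] [Algebra C E]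
  [IsScalarTower C F E]

omit [CharZero C] [Differential F] [Algebra F E] [DifferentialAlgebra F E] [Algebra C F]
  [IsScalarTower C F E] in
lemma exists_sum_of_mem_logSpan {S : Set E} {x : E} (hx : x ∈ logSpan C S) :
    ∃ (m : ℕ) (c : Fin m → C) (u : Fin m → E), (∀ j, u j ∈ S ∧ u j ≠ 0) ∧
      x = ∑ j, c j • ((u j)′ / u j) := by
  obtain ⟨m, c, g, rfl⟩ := Submodule.mem_span_set'.1 hx
  choose u hu h0 he using fun j => (g j).2
  exact ⟨m, c, u, fun j => ⟨hu j, h0 j⟩, Finset.sum_congr rfl fun j _ => by rw [he]⟩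

variable (hconst : ∀ x : E, x′ = 0 → ∃ c : C, algebraMap C E c = x)
  (hC : ∀ c : C, (algebraMap C E c)′ = 0)

include hC in
omit [CharZero C] in
lemma deriv_algebraMap_const (c : C) : (algebraMap C F c)′ = 0 := by
  apply (algebraMap F E).injective
  rw [← deriv_algebraMap, ← IsScalarTower.algebraMap_apply, hC, map_zero]

include hconst in
omit [CharZero C] in
lemma exists_const_of_deriv_eq_zero {x : F} (hx : x′ = 0) : ∃ c : C, algebraMap C F c = x := by
  obtain ⟨c, hc⟩ := hconst (algebraMap F E x) (by rw [deriv_algebraMap, hx, map_zero])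
  exact ⟨c, (algebraMap F E).injective (by rw [← IsScalarTower.algebraMap_apply, hc])⟩

include hconst hC in
lemma liouville_of_isAlgebraic {θ : E} (hθ : IsAlgebraic F θ) {f : F} {v x : E} (hv : v ∈ F⟮θ⟯)
    (hx : x ∈ logSpan C (F⟮θ⟯ : Set E)) (e : algebraMap F E f = v′ + x) :
    ∃ w : F, ∃ y ∈ logSpan C (Set.univ : Set F), f = w′ + y := by
  have : CharZero F := charZero_of_injective_algebraMap (algebraMap C F).injective
  have : FiniteDimensional F F⟮θ⟯ := adjoin.finiteDimensional hθ.isIntegral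
  obtain ⟨m, c, u, hu, rfl⟩ := exists_sum_of_mem_logSpan hx
  obtain ⟨ι, _, c', hc', u', w, e'⟩ := IsLiouville.isLiouville (K := F⟮θ⟯) f (Fin m)
    (fun j => algebraMap C F (c j)) (fun j => deriv_algebraMap_const hC (c j))
    (fun j => ⟨u j, (hu j).1⟩) ⟨v, hv⟩ (by
      apply (algebraMap F⟮θ⟯ E).injective
      rw [map_add, map_sum, ← deriv_algebraMap]
      simp only [map_mul, ← logDeriv_algebraMap]
      refine e.trans ?_
      rw [add_comm]
      refine congrArg₂ _ (Finset.sum_congr rfl fun j _ => ?_) rfl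
      rw [Algebra.smul_def, IsScalarTower.algebraMap_apply C F E]
      rfl)
  refine ⟨w, _, ?_, e'.trans (add_comm _ _)⟩
  refine Submodule.sum_mem _ fun j _ => ?_
  obtain ⟨d, hd⟩ := exists_const_of_deriv_eq_zero hconst (hc' j)
  rw [← hd, ← Algebra.smul_def]
  by_cases h0 : u' j = 0
  · simp [h0]
  · exact Submodule.smul_mem _ _ (div_mem_logSpan (Set.mem_univ _) h0)

include hconst in
-- Without new constants `θ` is a primitive monomial. Hermite reduction of the constant polynomial
-- `f` gives `f = w′ + c b′/b + y`, and `b′/b` is itself a logarithmic derivative.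
lemma liouville_of_log {θ : E} (hθ : Transcendental F θ) {b : F} (hb : b ≠ 0)
    (hθb : θ′ = (algebraMap F E b)′ / algebraMap F E b) {f : F} {v x : E} (hv : v ∈ F⟮θ⟯)
    (hx : x ∈ logSpan C (F⟮θ⟯ : Set E)) (e : algebraMap F E f = v′ + x) :
    ∃ w : F, ∃ y ∈ logSpan C (Set.univ : Set F), f = w′ + y := by
  have : CharZero F := charZero_of_injective_algebraMap (algebraMap C F).injective
  have hθ' : θ′ = algebraMap F E (b′ / b) := by rw [hθb, deriv_algebraMap, map_div₀]
  have ht : IsPrimitiveWith (b′ / b) θ := ⟨hθ', hθ, fun w hw => by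
    obtain ⟨c, hc⟩ := hconst (θ - algebraMap F E w) (by
      rw [map_sub, hθ', deriv_algebraMap, hw, sub_self])
    refine hθ ?_
    have : θ = algebraMap F E (algebraMap C F c + w) := by
      rw [map_add, ← IsScalarTower.algebraMap_apply, hc]; ring
    rw [this]; exact isAlgebraic_algebraMap _⟩
  obtain ⟨-, H, y, hy, hP⟩ := hermite_reduction ht (P := Polynomial.C f) isSimple_zero hv hx
    (by simpa using e)
  obtain ⟨w, c, hc, hl⟩ := leadingCoeff_implicitDeriv_add_C ht hP
  obtain ⟨d, rfl⟩ := exists_const_of_deriv_eq_zero hconst hc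
  rw [leadingCoeff_C, natDegree_C, if_pos rfl, add_assoc, ← Algebra.smul_def] at hl
  exact ⟨w, _, add_mem (Submodule.smul_mem _ _ (div_mem_logSpan (Set.mem_univ _) hb)) hy, hl⟩

/-- `x = A(θ)/B(θ)` with `B(0) ≠ 0` and `A(0)/B(0) = a`. -/
def EvalAtZero (θ x : E) (a : F) : Prop :=
  ∃ A B : F[X], B.coeff 0 ≠ 0 ∧ x = aeval θ A / aeval θ B ∧ a = A.coeff 0 / B.coeff 0

namespace EvalAtZero

variable {θ : E} (hθ : Transcendental F θ)

omit [Differential F] [Differential E] [DifferentialAlgebra F E] in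
lemma of_base (a : F) : EvalAtZero θ (algebraMap F E a) a :=
  ⟨C a, 1, by simp, by simp, by simp⟩

omit [Differential F] [Differential E] [DifferentialAlgebra F E] in
lemma self : EvalAtZero θ θ (0 : F) := ⟨X, 1, by simp, by simp, by simp⟩

include hθ

omit [Differential F] [Differential E] [DifferentialAlgebra F E] in
lemma add {x y : E} {a b : F} (hx : EvalAtZero θ x a) (hy : EvalAtZero θ y b) :
    EvalAtZero θ (x + y) (a + b) := by
  obtain ⟨A, B, hB, rfl, rfl⟩ := hx
  obtain ⟨A', B', hB', rfl, rfl⟩ := hy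
  have h1 := aeval_ne_zero hθ (P := B) (by rintro rfl; simp at hB)
  have h2 := aeval_ne_zero hθ (P := B') (by rintro rfl; simp at hB')
  exact ⟨A * B' + B * A', B * B', by simp [mul_coeff_zero, hB, hB'],
    by rw [div_add_div _ _ h1 h2]; simp, by rw [div_add_div _ _ hB hB']; simp [mul_coeff_zero]⟩

omit [Differential F] [Differential E] [DifferentialAlgebra F E] hθ in
lemma mul {x y : E} {a b : F} (hx : EvalAtZero θ x a) (hy : EvalAtZero θ y b) :
    EvalAtZero θ (x * y) (a * b) := by
  obtain ⟨A, B, hB, rfl, rfl⟩ := hx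
  obtain ⟨A', B', hB', rfl, rfl⟩ := hy
  exact ⟨A * A', B * B', by simp [mul_coeff_zero, hB, hB'],
    by rw [div_mul_div_comm]; simp, by rw [div_mul_div_comm]; simp [mul_coeff_zero]⟩

omit [Differential F] [Differential E] [DifferentialAlgebra F E] hθ in
lemma inv {x : E} {a : F} (hx : EvalAtZero θ x a) (ha : a ≠ 0) : EvalAtZero θ x⁻¹ a⁻¹ := by
  obtain ⟨A, B, hB, rfl, rfl⟩ := hx
  exact ⟨B, A, fun h => ha (by simp [h]), by rw [inv_div], by rw [inv_div]⟩

omit [Differential F] [Differential E] [DifferentialAlgebra F E] in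
lemma unique {x : E} {a b : F} (hx : EvalAtZero θ x a) (hy : EvalAtZero θ x b) : a = b := by
  obtain ⟨A, B, hB, rfl, rfl⟩ := hx
  obtain ⟨A', B', hB', e, rfl⟩ := hy
  have h1 := aeval_ne_zero hθ (P := B) (by rintro rfl; simp at hB)
  have h2 := aeval_ne_zero hθ (P := B') (by rintro rfl; simp at hB')
  rw [div_eq_div_iff h1 h2, ← map_mul, ← map_mul] at e
  have := congrArg (coeff · 0) (transcendental_iff_injective.1 hθ e)
  rw [div_eq_div_iff hB hB']
  simpa [mul_coeff_zero] using this

/-- Since `θ′ = β θ`, the derivation preserves the ideal generated by `θ`, so evaluation at `θ = 0`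
commutes with it. -/
lemma deriv {β : F} (hβ : θ′ = algebraMap F E β * θ) {x : E} {a : F}
    (hx : EvalAtZero θ x a) : EvalAtZero θ x′ a′ := by
  obtain ⟨A, B, hB, rfl, rfl⟩ := hx
  have h1 := aeval_ne_zero hθ (P := B) (by rintro rfl; simp at hB)
  have hD : ∀ P : F[X], (implicitDeriv (C β * X) P).coeff 0 = (P.coeff 0)′ := fun P => by
    simp [implicitDeriv, mul_coeff_zero]
  have hd := fun P : F[X] => deriv_aeval_eq_implicitDeriv θ (C β * X) (by simpa using hβ) P
  refine ⟨B * implicitDeriv (C β * X) A - A * implicitDeriv (C β * X) B, B ^ 2,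
    by simp [pow_two, mul_coeff_zero, hB], ?_, ?_⟩
  · rw [Derivation.leibniz_div, hd, hd]
    simp only [map_sub, map_mul, map_pow, smul_eq_mul]
    field_simp
  · rw [Derivation.leibniz_div]
    simp only [pow_two, coeff_sub, mul_coeff_zero, hD, smul_eq_mul]
    field_simp

omit [Differential F] [Differential E] [DifferentialAlgebra F E] in
lemma exists_of_mem_adjoin {u : E} (hu : u ∈ F⟮θ⟯) (h0 : u ≠ 0) :
    ∃ (m n : ℕ) (w : E) (a : F), a ≠ 0 ∧ EvalAtZero θ w a ∧ w ≠ 0 ∧ θ ^ m * u = θ ^ n * w := by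
  obtain ⟨A, B, rfl⟩ := (mem_adjoin_simple_iff F u).1 hu
  have hA : A ≠ 0 := by rintro rfl; simp at h0
  have hB : B ≠ 0 := by rintro rfl; simp at h0
  obtain ⟨A', hA', hXA⟩ := exists_eq_pow_rootMultiplicity_mul_and_not_dvd A hA 0
  obtain ⟨B', hB', hXB⟩ := exists_eq_pow_rootMultiplicity_mul_and_not_dvd B hB 0
  rw [C_0, sub_zero] at hA' hXA hB' hXB
  rw [X_dvd_iff] at hXA hXB
  have h1 := aeval_ne_zero hθ hB
  have h2 := aeval_ne_zero hθ (P := B') (by rintro rfl; simp at hXB)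
  have h3 := aeval_ne_zero hθ (P := A') (by rintro rfl; simp at hXA)
  refine ⟨B.rootMultiplicity 0, A.rootMultiplicity 0, aeval θ A' / aeval θ B', _, div_ne_zero hXA hXB, ⟨A', B', hXB, rfl, rfl⟩,
    div_ne_zero h3 h2, ?_⟩
  rw [mul_div_assoc', mul_div_assoc', div_eq_div_iff h1 h2]
  conv_lhs => rw [hA']
  conv_rhs => rw [hB']
  simp only [map_mul, map_pow, aeval_X]
  ring

end EvalAtZero

omit [CharZero C] in
-- Writing `u` as `θ ^ (n - m) * w` with `w` regular and nonzero at `θ = 0` gives `u′/u = (n - m) b′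
-- + w′/w`. So logarithmic derivatives have no pole at `0`, and their value there is a derivative
-- plus a logarithmic derivative.
lemma evalAtZero_logSpan {θ : E} (hθ : Transcendental F θ) {b : F}
    (hβ : θ′ = algebraMap F E b′ * θ) (hC : ∀ c : C, (algebraMap C E c)′ = 0) {x : E}
    (hx : x ∈ logSpan C (F⟮θ⟯ : Set E)) : ∃ w : F, ∃ y ∈ logSpan C (Set.univ : Set F),
      EvalAtZero θ x (w′ + y) := by
  have hθ0 : θ ≠ 0 := by rintro rfl; exact hθ isAlgebraic_zero
  induction hx using Submodule.span_induction with
  | mem x hx =>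
    obtain ⟨u, hu, h0, rfl⟩ := hx
    obtain ⟨m, n, w, a, ha, hw, hw0, e⟩ := EvalAtZero.exists_of_mem_adjoin hθ hu h0
    refine ⟨(n - m : F) * b, a′ / a, div_mem_logSpan (Set.mem_univ _) ha, ?_⟩
    have hlθ : Differential.logDeriv θ = algebraMap F E b′ := by
      rw [Differential.logDeriv, hβ, mul_div_cancel_right₀ _ hθ0]
    have h1 := congrArg Differential.logDeriv e
    rw [logDeriv_mul _ _ (pow_ne_zero _ hθ0) h0, logDeriv_mul _ _ (pow_ne_zero _ hθ0) hw0,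
      Differential.logDeriv_pow, Differential.logDeriv_pow, hlθ] at h1
    have h2 : u′ / u = algebraMap F E ((n - m : F) * b)′ + w′ * w⁻¹ := by
      rw [← div_eq_mul_inv]
      change Differential.logDeriv u = _ + Differential.logDeriv w
      rw [eq_sub_of_add_eq' h1, Derivation.leibniz]
      simp only [map_sub, Derivation.map_natCast, smul_eq_mul, sub_self, mul_zero, add_zero,
        map_mul, map_natCast]
      ring
    rw [h2, div_eq_mul_inv]
    exact (EvalAtZero.of_base _).add hθ ((hw.deriv hθ hβ).mul (hw.inv ha))
  | zero => exact ⟨0, 0, zero_mem _, by simpa using EvalAtZero.of_base (E := E) (0 : F)⟩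
  | add x y _ _ hx hy =>
    obtain ⟨w, y, hy', h⟩ := hx
    obtain ⟨w', y', hy'', h'⟩ := hy
    refine ⟨w + w', y + y', add_mem hy' hy'', ?_⟩
    convert h.add hθ h' using 1
    rw [map_add]; ring
  | smul c x _ hx =>
    obtain ⟨w, y, hy', h⟩ := hx
    refine ⟨c • w, c • y, Submodule.smul_mem _ _ hy', ?_⟩
    rw [deriv_smul (deriv_algebraMap_const hC), ← smul_add, Algebra.smul_def, Algebra.smul_def,
      IsScalarTower.algebraMap_apply C F E]
    exact (EvalAtZero.of_base _).mul h

include hconst hC in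
omit [CharZero C] in
-- The identity is evaluated at `θ = 0`, which is legitimate once `v` has no pole there.
lemma liouville_of_exp {θ : E} (hθ : Transcendental F θ) {b : F}
    (hθb : θ′ / θ = (algebraMap F E b)′) {f : F} {v x : E} (hv : v ∈ F⟮θ⟯)
    (hx : x ∈ logSpan C (F⟮θ⟯ : Set E)) (e : algebraMap F E f = v′ + x) :
    ∃ w : F, ∃ y ∈ logSpan C (Set.univ : Set F), f = w′ + y := by
  have hθ0 : θ ≠ 0 := by rintro rfl; exact hθ isAlgebraic_zero
  have hβ : θ′ = algebraMap F E b′ * θ := by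
    rw [← deriv_algebraMap, ← hθb, div_mul_cancel₀ _ hθ0]
  obtain ⟨w, y, hy, hxy⟩ := evalAtZero_logSpan hθ hβ hC hx
  suffices h : ∃ a : F, EvalAtZero θ v a by
    obtain ⟨a, ha⟩ := h
    refine ⟨a + w, y, hy, ?_⟩
    rw [map_add, add_assoc]
    exact (EvalAtZero.of_base (E := E) f).unique hθ (e ▸ (ha.deriv hθ hβ).add hθ hxy)
  by_cases h0 : v = 0
  · exact ⟨0, by rw [h0]; simpa using EvalAtZero.of_base (E := E) (0 : F)⟩
  obtain ⟨m, n, z, a, ha, hz, hz0, e'⟩ := EvalAtZero.exists_of_mem_adjoin hθ hv h0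
  have hpow : ∀ k, EvalAtZero θ (θ ^ k) ((0 : F) ^ k) := fun k => by
    induction k with
    | zero => simpa using EvalAtZero.of_base (E := E) (1 : F)
    | succ k ih => rw [pow_succ, pow_succ]; exact ih.mul EvalAtZero.self
  rcases le_or_gt m n with hmn | hmn
  · obtain ⟨k, rfl⟩ := Nat.exists_eq_add_of_le hmn
    rw [pow_add, mul_assoc] at e'
    rw [mul_left_cancel₀ (pow_ne_zero m hθ0) e']
    exact ⟨_, (hpow k).mul hz⟩
  -- Suppose `v = z / θ ^ N` with `N > 0` and `z` taking the value `a ≠ 0`. As `v′ = f - x` is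
  -- regular at `0`, evaluating `θ ^ N v′ + N b′ z = z′` gives `a′ = N b′ a`. Then `a / θ ^ N` is a
  -- constant, so `θ` is algebraic.
  exfalso
  obtain ⟨k, rfl⟩ := Nat.exists_eq_add_of_lt hmn
  rw [add_assoc, pow_add, mul_assoc] at e'
  have e' := mul_left_cancel₀ (pow_ne_zero n hθ0) e'
  set N := k + 1 with hN
  have hdN : (θ ^ N)′ = (N : E) * algebraMap F E b′ * θ ^ N := by
    rw [Derivation.leibniz_pow, hβ, hN]
    simp only [smul_eq_mul, nsmul_eq_mul, Nat.add_sub_cancel]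
    ring
  have h1 : θ ^ N * v′ + algebraMap F E (N * b′) * z = z′ := by
    rw [← e', Derivation.leibniz, hdN, map_mul, map_natCast, smul_eq_mul, smul_eq_mul]
    ring
  have hv' : EvalAtZero θ v′ (f + (algebraMap C F (-1) * (w′ + y))) := by
    have : v′ = algebraMap F E f + algebraMap F E (algebraMap C F (-1)) * x := by
      rw [e]; simp
    rw [this]
    exact (EvalAtZero.of_base f).add hθ ((EvalAtZero.of_base _).mul hxy)
  have h2 := (((hpow N).mul hv').add hθ ((EvalAtZero.of_base (E := E) (N * b′)).mul hz)).unique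
    hθ (h1 ▸ hz.deriv hθ hβ)
  rw [zero_pow (by omega), zero_mul, zero_add] at h2
  obtain ⟨c, hc⟩ := hconst (algebraMap F E a / θ ^ N) (by
    rw [Derivation.leibniz_div, hdN, deriv_algebraMap, ← h2]
    simp only [map_mul, map_natCast, smul_eq_mul]
    ring)
  have h3 : aeval θ (Polynomial.C (algebraMap C F c) * X ^ N - Polynomial.C a) = 0 := by
    simp only [map_sub, map_mul, aeval_C, map_pow, aeval_X, ← IsScalarTower.algebraMap_apply, hc]
    rw [div_mul_cancel₀ _ (pow_ne_zero N hθ0), sub_self]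
  have h4 := congrArg (coeff · 0) ((transcendental_iff.1 hθ) _ h3)
  simp [mul_coeff_zero, hN, ha] at h4

include hconst hC in
/-- One step of Liouville's theorem, without new constants. -/
lemma liouville_step {θ : E} (hθ : IsElementaryOver F θ) {f : F} {v x : E} (hv : v ∈ F⟮θ⟯)
    (hx : x ∈ logSpan C (F⟮θ⟯ : Set E)) (e : algebraMap F E f = v′ + x) :
    ∃ w : F, ∃ y ∈ logSpan C (Set.univ : Set F), f = w′ + y := by
  by_cases halg : IsAlgebraic F θ
  · exact liouville_of_isAlgebraic hconst hC halg hv hx e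
  rcases hθ with h | ⟨b, hb, h⟩ | ⟨-, b, h⟩
  · exact absurd h halg
  · exact liouville_of_log hconst halg hb h hv hx e
  · exact liouville_of_exp hconst hC halg h hv hx e

end LiouvilleStep
end DiffTower

namespace DiffTower
open Differential IntermediateField

/-! ### Differentiating coefficients of multivariate polynomials -/

section MapCoeffs

variable {σ A : Type*} [CommRing A] [Differential A]

open MvPolynomial in
/-- The derivation of `A[x]` that differentiates the coefficients. -/
noncomputable def mvMapCoeffs : Derivation ℤ (MvPolynomial σ A) (MvPolynomial σ A) :=
  have hc : ∀ (P : MvPolynomial σ A) (m : σ →₀ ℕ),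
      coeff m (∑ d ∈ P.support, monomial d (coeff d P)′) = (coeff m P)′ := fun P m => by
    classical
    rw [coeff_sum]
    simp only [coeff_monomial, Finset.sum_ite_eq', mem_support_iff]
    split_ifs with h
    · rfl
    · rw [not_not.1 h, map_zero]
  Derivation.mk'
    (AddMonoidHom.toIntLinearMap
      { toFun := fun P => ∑ d ∈ P.support, monomial d (coeff d P)′
        map_zero' := by simp
        map_add' := fun P Q => by ext m; rw [coeff_add, hc, hc, hc, coeff_add, map_add] }) fun P Q => by
    classical
    ext m
    change coeff m (∑ d ∈ (P * Q).support, monomial d (coeff d (P * Q))′) =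
      coeff m (P * ∑ d ∈ Q.support, monomial d (coeff d Q)′ +
        Q * ∑ d ∈ P.support, monomial d (coeff d P)′)
    rw [hc, mul_comm Q, coeff_add, coeff_mul, coeff_mul, coeff_mul, map_sum,
      ← Finset.sum_add_distrib]
    refine Finset.sum_congr rfl fun x _ => ?_
    rw [hc, hc, Derivation.leibniz, smul_eq_mul, smul_eq_mul]
    ring

open MvPolynomial in
lemma coeff_mvMapCoeffs (P : MvPolynomial σ A) (m : σ →₀ ℕ) :
    coeff m (mvMapCoeffs P) = (coeff m P)′ := by
  classical
  change coeff m (∑ d ∈ P.support, monomial d (coeff d P)′) = _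
  rw [coeff_sum]
  simp only [coeff_monomial, Finset.sum_ite_eq', mem_support_iff]
  split_ifs with h
  · rfl
  · rw [not_not.1 h, map_zero]

@[simp]
lemma mvMapCoeffs_C (a : A) :
    mvMapCoeffs (MvPolynomial.C a : MvPolynomial σ A) = MvPolynomial.C a′ := by
  classical
  ext m
  rw [coeff_mvMapCoeffs, MvPolynomial.coeff_C, MvPolynomial.coeff_C]
  split_ifs <;> simp

@[simp]
lemma mvMapCoeffs_X (i : σ) : mvMapCoeffs (MvPolynomial.X i : MvPolynomial σ A) = 0 := by
  classical
  ext m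
  rw [coeff_mvMapCoeffs, MvPolynomial.coeff_X]
  split_ifs <;> simp

lemma deriv_aeval_of_deriv_eq_zero {B : Type*} [CommRing B] [Differential B] [Algebra A B]
    [DifferentialAlgebra A B] {c : σ → B} (hc : ∀ i, (c i)′ = 0) (P : MvPolynomial σ A) :
    (MvPolynomial.aeval c P)′ = MvPolynomial.aeval c (mvMapCoeffs P) := by
  induction P using MvPolynomial.induction_on with
  | C a => simp [deriv_algebraMap]
  | add P Q hP hQ => simp [hP, hQ]
  | mul_X P i hP => simp [hP, hc]

end MapCoeffs

/-! ### Specializing constants of an extension to `C` -/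

section Specialization

variable {C K E : Type*} [Field C] [Field K] [Field E] [Algebra C K] [Algebra C E] [Algebra K E]
  [IsScalarTower C K E]

/-- Constants that are linearly independent over the constants of `K` are so over `K`. -/
lemma linearIndependent_of_deriv_eq_zero [Differential K] [Differential E]
    [DifferentialAlgebra K E] (hconst : ∀ x : K, x′ = 0 → ∃ c : C, algebraMap C K c = x)
    {ι : Type*} {e : ι → E} (he : ∀ i, (e i)′ = 0) (hli : LinearIndependent C e) :
    LinearIndependent K e := by
  classical
  rw [linearIndependent_iff']
  intro s
  induction s using Finset.induction_on with
  | empty => simp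
  | insert i₀ s hi₀ ih =>
    intro g hg
    have h0 : g i₀ = 0 := by
      by_contra h0
      rw [Finset.sum_insert hi₀] at hg
      have h1 : e i₀ + ∑ i ∈ s, (g i / g i₀) • e i = 0 := by
        have := congrArg ((g i₀)⁻¹ • ·) hg
        simp only [smul_add, Finset.smul_sum, smul_smul, inv_mul_cancel₀ h0, one_smul,
          smul_zero] at this
        simpa only [div_eq_inv_mul] using this
      -- With the coefficient of `e i₀` normalized to `1`, differentiation yields a shorter
      -- relation. By induction all ratios `g i / g i₀` are constants, which contradicts
      -- independence over `C`.
      have h2 : ∑ i ∈ s, (g i / g i₀)′ • e i = 0 := by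
        have := congrArg (fun x : E => x′) h1
        simp only [map_add, map_sum, map_zero, he, zero_add, Algebra.smul_def, Derivation.leibniz,
          deriv_algebraMap, mul_zero] at this
        simpa only [Algebra.smul_def, Algebra.algebraMap_self, RingHom.id_apply, mul_comm] using this
      have h3 := ih _ h2
      choose! c hc using fun i (hi : i ∈ s) => hconst _ (h3 i hi)
      have h4 := linearIndependent_iff'.1 hli (insert i₀ s) (fun i => if i = i₀ then 1 else c i)
        (by
          rw [Finset.sum_insert hi₀, if_pos rfl, one_smul, ← h1]
          congr 1
          refine Finset.sum_congr rfl fun i hi => ?_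
          rw [if_neg (by rintro rfl; exact hi₀ hi), ← hc i hi, algebraMap_smul])
        i₀ (Finset.mem_insert_self _ _)
      simp at h4
    rw [Finset.sum_insert hi₀, h0, zero_smul, zero_add] at hg
    intro i hi
    rcases Finset.mem_insert.1 hi with rfl | hi
    · exact h0
    · exact ih g hg i hi

/-- The Nullstellensatz with Rabinowitsch's trick: after inverting `r`, the residue field at a
maximal ideal is finite over `C`, hence equal to `C`, and the image of `r` is a unit. -/
lemma exists_algHom_ne_zero [IsAlgClosed C] {s : Set E} (hs : s.Finite)
    {r : E} (hr : r ∈ Algebra.adjoin C s) (h0 : r ≠ 0) :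
    ∃ χ : Algebra.adjoin C s →ₐ[C] C, χ ⟨r, hr⟩ ≠ 0 := by
  set R := Algebra.adjoin C (insert r⁻¹ s) with hR
  have hfg : Algebra.FiniteType C R :=
    (Subalgebra.fg_iff_finiteType R).1 (Subalgebra.fg_def.2 ⟨_, hs.insert _, rfl⟩)
  obtain ⟨M, hM⟩ := Ideal.exists_maximal R
  let _ := Ideal.Quotient.field M
  have : Module.Finite C (R ⧸ M) := finite_of_finite_type_of_isJacobsonRing C (R ⧸ M)
  let e := AlgEquiv.ofBijective (Algebra.ofId C (R ⧸ M))
    IsAlgClosed.algebraMap_bijective_of_isIntegral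
  have hle : Algebra.adjoin C s ≤ R := Algebra.adjoin_mono (Set.subset_insert _ _)
  refine ⟨(e.symm.toAlgHom.comp (Ideal.Quotient.mkₐ C M)).comp (Subalgebra.inclusion hle),
    fun h => ?_⟩
  have hr' : r⁻¹ ∈ R := Algebra.subset_adjoin (Set.mem_insert _ _)
  have h1 : (⟨r, hle hr⟩ : R) * ⟨r⁻¹, hr'⟩ = 1 := Subtype.ext (mul_inv_cancel₀ h0)
  have h2 := congrArg (e.symm.toAlgHom.comp (Ideal.Quotient.mkₐ C M)) h1
  rw [map_mul, map_one] at h2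
  have h3 : (e.symm.toAlgHom.comp (Ideal.Quotient.mkₐ C M)) ⟨r, hle hr⟩ = 0 := h
  rw [h3, zero_mul] at h2
  exact zero_ne_one h2

lemma exists_finset_sum_basis {V ι : Type*} [AddCommGroup V] [Module C V] (b : Module.Basis ι C V)
    {κ : Type*} (s : Finset κ) (v : κ → V) :
    ∃ J : Finset ι, ∀ m ∈ s, v m = ∑ j ∈ J, b.repr (v m) j • b j := by
  classical
  refine ⟨s.biUnion fun m => (b.repr (v m)).support, fun m hm => ?_⟩
  conv_lhs => rw [← b.linearCombination_repr (v m), Finsupp.linearCombination_apply]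
  exact Finsupp.sum_of_support_subset _ (Finset.subset_biUnion_of_mem
    (fun m => (b.repr (v m)).support) hm) _ (by simp)

/-- A `C`-basis of the algebra `R` generated by the constants `c i` stays independent over `K`.
Relations over `K` among the `c i` therefore reduce to relations over `C`, which every homomorphism
`R → C` preserves; one is chosen that keeps `Q` nonzero. -/
lemma exists_specialization [IsAlgClosed C] [Differential K] [Differential E]
    [DifferentialAlgebra K E] (hconst : ∀ x : K, x′ = 0 → ∃ c : C, algebraMap C K c = x)
    (hC : ∀ c : C, (algebraMap C E c)′ = 0)
    {σ : Type*} [Finite σ] {c : σ → E} (hc : ∀ i, (c i)′ = 0) {Q : MvPolynomial σ K}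
    (hQ : MvPolynomial.aeval c Q ≠ 0) : ∃ χ : σ → C,
      (∀ P : MvPolynomial σ K, MvPolynomial.aeval c P = 0 →
        MvPolynomial.aeval (fun i => algebraMap C K (χ i)) P = 0) ∧
      MvPolynomial.aeval (fun i => algebraMap C K (χ i)) Q ≠ 0 := by
  classical
  set R := Algebra.adjoin C (Set.range c) with hR
  have hRconst : ∀ x ∈ R, x′ = 0 := fun x hx => by
    induction hx using Algebra.adjoin_induction with
    | mem x hx => obtain ⟨i, rfl⟩ := hx; exact hc i
    | algebraMap a => exact hC a
    | add x y _ _ hx hy => rw [map_add, hx, hy, add_zero]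
    | mul x y _ _ hx hy => rw [Derivation.leibniz, hx, hy]; simp
  let cR : σ → R := fun i => ⟨c i, Algebra.subset_adjoin ⟨i, rfl⟩⟩
  let mon : (σ →₀ ℕ) → R := fun m => ∏ i ∈ m.support, cR i ^ m i
  have hsumE : ∀ P : MvPolynomial σ K, MvPolynomial.aeval c P =
      ∑ m ∈ P.support, algebraMap K E (MvPolynomial.coeff m P) * (mon m : E) := fun P => by
    rw [MvPolynomial.aeval_def, MvPolynomial.eval₂_eq]
    refine Finset.sum_congr rfl fun m _ => ?_
    simp [mon, cR]
  have hsumK : ∀ (χ : R →ₐ[C] C) (P : MvPolynomial σ K),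
      MvPolynomial.aeval (fun i => algebraMap C K (χ (cR i))) P =
      ∑ m ∈ P.support, MvPolynomial.coeff m P * algebraMap C K (χ (mon m)) := fun χ P => by
    rw [MvPolynomial.aeval_def, MvPolynomial.eval₂_eq]
    refine Finset.sum_congr rfl fun m _ => ?_
    simp [mon]
  -- a nonzero element of `R` obtained from a coordinate of the coefficients of `Q`
  obtain ⟨ℓ, hℓ⟩ : ∃ ℓ : K →ₗ[C] C,
      ∑ m ∈ Q.support, ℓ (MvPolynomial.coeff m Q) • mon m ≠ 0 := by
    by_contra! hall
    apply hQ
    let b := Module.Basis.ofVectorSpace C K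
    obtain ⟨J, hJ⟩ := exists_finset_sum_basis b Q.support (fun m => MvPolynomial.coeff m Q)
    rw [hsumE]
    calc _ = ∑ m ∈ Q.support, ∑ j ∈ J, algebraMap K E (b j) *
          ((b.coord j (MvPolynomial.coeff m Q) • mon m : R) : E) := by
          refine Finset.sum_congr rfl fun m hm => ?_
          conv_lhs => rw [hJ m hm, map_sum, Finset.sum_mul]
          refine Finset.sum_congr rfl fun j _ => ?_
          rw [algebraMap_smul_of_tower]
          simp
      _ = ∑ j ∈ J, algebraMap K E (b j) *
          ((∑ m ∈ Q.support, b.coord j (MvPolynomial.coeff m Q) • mon m : R) : E) := by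
          rw [Finset.sum_comm]
          refine Finset.sum_congr rfl fun j _ => ?_
          rw [← Finset.mul_sum]
          simp
      _ = 0 := Finset.sum_eq_zero fun j _ => by rw [hall]; simp
  set r := ∑ m ∈ Q.support, ℓ (MvPolynomial.coeff m Q) • mon m with hr
  obtain ⟨χ, hχ⟩ := exists_algHom_ne_zero (Set.finite_range c) r.2 (by simpa using hℓ)
  refine ⟨fun i => χ (cR i), fun P hP => ?_, fun h => hχ ?_⟩
  · let b := Module.Basis.ofVectorSpace C R
    obtain ⟨J, hJ⟩ := exists_finset_sum_basis b P.support mon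
    have hli : LinearIndependent C (fun j => (b j : E)) :=
      b.linearIndependent.map' R.val.toLinearMap (LinearMap.ker_eq_bot.2 Subtype.val_injective)
    have hli' := linearIndependent_of_deriv_eq_zero hconst (fun j => hRconst _ (b j).2) hli
    have h1 : ∑ j ∈ J, (∑ m ∈ P.support,
        MvPolynomial.coeff m P * algebraMap C K (b.repr (mon m) j)) • (b j : E) = 0 := by
      rw [← hP, hsumE]
      simp only [Finset.sum_smul]
      rw [Finset.sum_comm]
      refine Finset.sum_congr rfl fun m hm => ?_
      conv_rhs => rw [hJ m hm]
      rw [AddSubmonoidClass.coe_finsetSum, Finset.mul_sum]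
      refine Finset.sum_congr rfl fun j _ => ?_
      rw [Algebra.smul_def, map_mul, ← IsScalarTower.algebraMap_apply, mul_assoc,
        Subalgebra.coe_smul, Algebra.smul_def]
    have h2 := linearIndependent_iff'.1 hli' J _ h1
    rw [hsumK]
    calc _ = ∑ m ∈ P.support, ∑ j ∈ J, MvPolynomial.coeff m P *
          algebraMap C K (b.repr (mon m) j) * algebraMap C K (χ (b j)) := by
          refine Finset.sum_congr rfl fun m hm => ?_
          conv_lhs => rw [hJ m hm, map_sum, map_sum, Finset.mul_sum]
          refine Finset.sum_congr rfl fun j _ => ?_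
          rw [map_smul, smul_eq_mul, map_mul, mul_assoc]
      _ = ∑ j ∈ J, (∑ m ∈ P.support, MvPolynomial.coeff m P *
          algebraMap C K (b.repr (mon m) j)) * algebraMap C K (χ (b j)) := by
          rw [Finset.sum_comm]
          exact Finset.sum_congr rfl fun j _ => by rw [Finset.sum_mul]
      _ = 0 := Finset.sum_eq_zero fun j hj => by rw [h2 j hj, zero_mul]
  -- Since `ℓ` is `C`-linear, applying it to the specialized value of `Q` gives `χ r`, which is
  -- nonzero.
  · have h1 := congrArg ℓ ((hsumK χ Q).symm.trans h)
    rw [map_sum, map_zero] at h1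
    rw [← h1]
    change χ r = _
    rw [hr, map_sum]
    refine Finset.sum_congr rfl fun m _ => ?_
    rw [map_smul, mul_comm, ← Algebra.smul_def, map_smul, smul_eq_mul, smul_eq_mul, mul_comm]

end Specialization

end DiffTower

namespace DiffTower
open Differential IntermediateField

/-! ### Specialization of quotients -/

section SpecializesTo

variable {A E L : Type*} [CommRing A] [Field E] [Field L]

/-- `x = φ P / φ Q` and `a = ψ P / ψ Q` for some `P, Q` with `ψ Q ≠ 0`. -/
def SpecializesTo (φ : A →+* E) (ψ : A →+* L) (x : E) (a : L) : Prop :=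
  ∃ P Q : A, ψ Q ≠ 0 ∧ x = φ P / φ Q ∧ a = ψ P / ψ Q

namespace SpecializesTo

variable {φ : A →+* E} {ψ : A →+* L}

lemma of_ring (P : A) : SpecializesTo φ ψ (φ P) (ψ P) := ⟨P, 1, by simp, by simp, by simp⟩

lemma mul {x y : E} {a b : L} (hx : SpecializesTo φ ψ x a) (hy : SpecializesTo φ ψ y b) :
    SpecializesTo φ ψ (x * y) (a * b) := by
  obtain ⟨P, Q, hQ, rfl, rfl⟩ := hx
  obtain ⟨P', Q', hQ', rfl, rfl⟩ := hy
  exact ⟨P * P', Q * Q', by simp [hQ, hQ'], by rw [div_mul_div_comm]; simp,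
    by rw [div_mul_div_comm]; simp⟩

lemma inv {x : E} {a : L} (hx : SpecializesTo φ ψ x a) (ha : a ≠ 0) :
    SpecializesTo φ ψ x⁻¹ a⁻¹ := by
  obtain ⟨P, Q, hQ, rfl, rfl⟩ := hx
  exact ⟨Q, P, fun h => ha (by simp [h]), by rw [inv_div], by rw [inv_div]⟩

variable (hker : ∀ P, φ P = 0 → ψ P = 0)
include hker

lemma add {x y : E} {a b : L} (hx : SpecializesTo φ ψ x a) (hy : SpecializesTo φ ψ y b) :
    SpecializesTo φ ψ (x + y) (a + b) := by
  obtain ⟨P, Q, hQ, rfl, rfl⟩ := hx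
  obtain ⟨P', Q', hQ', rfl, rfl⟩ := hy
  exact ⟨P * Q' + Q * P', Q * Q', by simp [hQ, hQ'],
    by rw [div_add_div _ _ (mt (hker Q) hQ) (mt (hker Q') hQ')]; simp,
    by rw [div_add_div _ _ hQ hQ']; simp⟩

lemma sum {ι : Type*} {s : Finset ι} {x : ι → E} {a : ι → L}
    (h : ∀ i ∈ s, SpecializesTo φ ψ (x i) (a i)) :
    SpecializesTo φ ψ (∑ i ∈ s, x i) (∑ i ∈ s, a i) := by
  classical
  induction s using Finset.induction_on with
  | empty => simpa using of_ring (φ := φ) (ψ := ψ) 0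
  | insert i s hi ih =>
    rw [Finset.sum_insert hi, Finset.sum_insert hi]
    exact (h i (Finset.mem_insert_self _ _)).add hker
      (ih fun j hj => h j (Finset.mem_insert_of_mem hj))

lemma unique {x : E} {a b : L} (hx : SpecializesTo φ ψ x a) (hy : SpecializesTo φ ψ x b) :
    a = b := by
  obtain ⟨P, Q, hQ, rfl, rfl⟩ := hx
  obtain ⟨P', Q', hQ', e, rfl⟩ := hy
  rw [div_eq_div_iff (mt (hker Q) hQ) (mt (hker Q') hQ'), ← map_mul, ← map_mul, ← sub_eq_zero,
    ← map_sub] at e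
  have := hker _ e
  rw [div_eq_div_iff hQ hQ', ← sub_eq_zero]
  simpa using this

lemma deriv [Differential E] [Differential L] {D : Derivation ℤ A A}
    (hφ : ∀ P, (φ P)′ = φ (D P)) (hψ : ∀ P, (ψ P)′ = ψ (D P)) {x : E} {a : L}
    (hx : SpecializesTo φ ψ x a) : SpecializesTo φ ψ x′ a′ := by
  obtain ⟨P, Q, hQ, rfl, rfl⟩ := hx
  have hQ' := mt (hker Q) hQ
  refine ⟨Q * D P - P * D Q, Q ^ 2, by simp [hQ], ?_, ?_⟩
  · rw [Derivation.leibniz_div, hφ, hφ]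
    simp only [map_sub, map_mul, map_pow, smul_eq_mul]
    field_simp
  · rw [Derivation.leibniz_div, hψ, hψ]
    simp only [map_sub, map_mul, map_pow, smul_eq_mul]
    field_simp

end SpecializesTo

end SpecializesTo

/-! ### Liouville's theorem with new constants -/

section StrongLiouville

/-- The field of constants. -/
def constField (E : Type*) [Field E] [Differential E] : Subfield E where
  carrier := {x | x′ = 0}
  mul_mem' := fun {a b} (ha : a′ = 0) (hb : b′ = 0) => by
    change (a * b)′ = 0
    rw [Derivation.leibniz, ha, hb]; simp
  one_mem' := Derivation.map_one_eq_zero _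
  add_mem' := fun {a b} (ha : a′ = 0) (hb : b′ = 0) => by
    change (a + b)′ = 0
    rw [map_add, ha, hb, add_zero]
  zero_mem' := map_zero _
  neg_mem' := fun {a} (ha : a′ = 0) => by
    change (-a)′ = 0
    rw [map_neg, ha, neg_zero]
  inv_mem' := fun a (ha : a′ = 0) => by
    change (a⁻¹)′ = 0
    rw [Derivation.leibniz_inv, ha, smul_zero]

variable {K E : Type*} [Field K] [Differential K] [Field E] [Differential E]
  [Algebra K E] [DifferentialAlgebra K E]

omit [Differential K] [DifferentialAlgebra K E] in
lemma IsElementaryOver.mono {k : Type*} [Field k] [Algebra k E] {A : IntermediateField K E}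
    {B : IntermediateField k E} (hAB : ∀ x ∈ A, x ∈ B) {θ : E} (h : IsElementaryOver A θ) :
    IsElementaryOver B θ := by
  rcases h with h | ⟨b, hb, h⟩ | ⟨h0, b, h⟩
  · let i : A →+* B :=
      { toFun := fun x => ⟨x, hAB _ x.2⟩
        map_one' := rfl
        map_zero' := rfl
        map_add' := fun _ _ => rfl
        map_mul' := fun _ _ => rfl }
    let _ := i.toAlgebra
    have : IsScalarTower A B E := IsScalarTower.of_algebraMap_eq fun _ => rfl
    exact Or.inl (h.tower_top B)
  · exact Or.inr (Or.inl ⟨⟨b, hAB _ b.2⟩, fun h => hb (Subtype.ext (show (b : E) = 0 from congrArg B.val h)), h⟩)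
  · exact Or.inr (Or.inr ⟨h0, ⟨b, hAB _ b.2⟩, h⟩)

lemma IsElementaryOver.deriv_mem [CharZero K] {θ : E} (h : IsElementaryOver K θ) :
    θ′ ∈ adjoin K {θ} := by
  have hθ := mem_adjoin_simple_self K θ
  rcases h with h | ⟨b, hb, h⟩ | ⟨h0, b, h⟩
  · have : FiniteDimensional K K⟮θ⟯ := adjoin.finiteDimensional h.isIntegral
    have := deriv_algebraMap (B := E) (⟨θ, hθ⟩ : K⟮θ⟯)
    change θ′ = _ at this
    rw [this]
    exact Subtype.property _
  · rw [h, deriv_algebraMap]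
    exact div_mem (IntermediateField.algebraMap_mem _ _) (IntermediateField.algebraMap_mem _ _)
  · rw [div_eq_iff h0, deriv_algebraMap] at h
    rw [h]
    exact mul_mem (IntermediateField.algebraMap_mem _ _) hθ

variable (K) in
/-- `k(K, θ₀, …, θ_{i-1})`, where `k` is the field of constants of `E`. -/
def constTower (θ : ℕ → E) (i : ℕ) : IntermediateField (constField E) E :=
  adjoin (constField E) (Set.range (algebraMap K E) ∪ θ '' Set.Iio i)

omit [Differential K] [DifferentialAlgebra K E] in
lemma constTower_mono (θ : ℕ → E) {i j : ℕ} (h : i ≤ j) : constTower K θ i ≤ constTower K θ j :=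
  adjoin.mono _ _ _ (Set.union_subset_union_right _ (Set.image_mono (Set.Iio_subset_Iio h)))

omit [Differential K] [DifferentialAlgebra K E] in
lemma mem_constTower {θ : ℕ → E} {i : ℕ} {x : E} (hx : x ∈ adjoin K (θ '' Set.Iio i)) :
    x ∈ constTower K θ i := by
  induction hx using adjoin_induction with
  | mem x hx => exact subset_adjoin _ _ (Or.inr hx)
  | algebraMap a => exact subset_adjoin _ _ (Or.inl ⟨a, rfl⟩)
  | add x y _ _ hx hy => exact add_mem hx hy
  | inv x _ hx => exact inv_mem hx
  | mul x y _ _ hx hy => exact mul_mem hx hy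

omit [Differential K] [DifferentialAlgebra K E] in
lemma mem_adjoin_constTower_iff {θ : ℕ → E} {i : ℕ} {x : E} :
    x ∈ adjoin (constTower K θ i) {θ i} ↔ x ∈ constTower K θ (i + 1) := by
  have : (adjoin (constTower K θ i) {θ i}).restrictScalars (constField E) =
      constTower K θ (i + 1) := by
    rw [constTower, adjoin_adjoin_left, constTower]
    congr 1
    rw [Set.union_assoc, ← Set.image_singleton, ← Set.image_union]
    congr 2
    ext i
    simp only [Set.mem_union, Set.mem_Iio, Set.mem_singleton_iff]
    omega
  rw [← this]; rfl

lemma derivClosed_constTower [CharZero K] {θ : ℕ → E} {m : ℕ}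
    (hθ : ∀ i < m, IsElementaryOver (adjoin K (θ '' Set.Iio i)) (θ i)) {i : ℕ} (hi : i ≤ m) :
    DerivClosed (constTower K θ i) := by
  have : CharZero E := charZero_of_injective_algebraMap (algebraMap K E).injective
  induction i using Nat.strong_induction_on with
  | _ i ih =>
  refine derivClosed_adjoin (fun c => c.2) ?_
  rintro _ (⟨a, rfl⟩ | ⟨j, hj, rfl⟩)
  · rw [deriv_algebraMap]; exact subset_adjoin _ _ (Or.inl ⟨_, rfl⟩)
  have hj : j < i := hj
  let _ := (ih j hj (by omega)).differential
  have := (ih j hj (by omega)).differentialAlgebra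
  have hc : CharZero (constTower K θ j) :=
    charZero_of_injective_algebraMap (algebraMap ℚ _).injective
  have h := ((hθ j (by omega)).mono (B := constTower K θ j) fun _ => mem_constTower).deriv_mem
  exact constTower_mono θ (by omega : j + 1 ≤ i) (mem_adjoin_constTower_iff.1 h)

/-- Over the compositum of `K` with all constants of `E`, no step of the tower creates a constant,
so `liouville_step` applies with `constField E` as constants. The descent starts at the top with `f
= z′` and no logarithmic terms. -/
lemma exists_mem_constTower_zero [CharZero K] (h : IsElementaryExtension K E) {f : K} {z : E}
    (hz : z′ = algebraMap K E f) : ∃ v ∈ adjoin (constField E) (Set.range (algebraMap K E)),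
      ∃ x ∈ logSpan (constField E)
        (adjoin (constField E) (Set.range (algebraMap K E)) : Set E),
      algebraMap K E f = v′ + x := by
  have : CharZero E := charZero_of_injective_algebraMap (algebraMap K E).injective
  obtain ⟨m, θ, hθ, htop⟩ := h
  suffices h : ∀ i ≤ m, ∃ v ∈ constTower K θ (m - i), ∃ x ∈ logSpan (constField E)
      (constTower K θ (m - i) : Set E), algebraMap K E f = v′ + x by
    have := h m le_rfl
    rw [Nat.sub_self] at this
    simpa [constTower] using this
  intro i
  induction i with
  | zero => exact fun _ => ⟨z, mem_constTower (htop ▸ mem_top), 0, zero_mem _, by rw [hz, add_zero]⟩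
  | succ i ih =>
    intro hi
    obtain ⟨v, hv, x, hx, e⟩ := ih (by omega)
    obtain ⟨j, hj⟩ : ∃ j, m - i = j + 1 := ⟨m - i - 1, by omega⟩
    have hj' : m - (i + 1) = j := by omega
    rw [hj] at hv hx
    rw [hj']
    have hcl := derivClosed_constTower hθ (by omega : j ≤ m)
    let _ := hcl.differential
    have := hcl.differentialAlgebra
    have hset : (adjoin (constTower K θ j) {θ j} : Set E) = (constTower K θ (j + 1) : Set E) :=
      Set.ext fun _ => mem_adjoin_constTower_iff
    have : CharZero (constField E) :=
      charZero_of_injective_algebraMap (algebraMap ℚ _).injective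
    have hf : algebraMap K E f ∈ constTower K θ j := subset_adjoin _ _ (Or.inl ⟨f, rfl⟩)
    obtain ⟨w, y, hy, e'⟩ := liouville_step (C := constField E) (F := constTower K θ j)
      (fun x hx => ⟨⟨x, hx⟩, rfl⟩) (fun c => c.2)
      ((hθ j (by omega)).mono (B := constTower K θ j) fun _ => mem_constTower)
      (f := ⟨_, hf⟩) (mem_adjoin_constTower_iff.2 hv) (hset ▸ hx) e
    refine ⟨w, w.2, algebraMap _ E y, algebraMap_mem_logSpan (fun a _ => a.2) hy, ?_⟩
    exact congrArg Subtype.val e'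

variable {C : Type*} [Field C] [IsAlgClosed C] [CharZero C] [Algebra C K]

/-- Liouville's theorem, new constants being allowed. -/
theorem liouville (hC : ∀ c : C, (algebraMap C K c)′ = 0)
    (hconst : ∀ x : K, x′ = 0 → ∃ c : C, algebraMap C K c = x) {f : K}
    (hf : IsElementarilyIntegrable f) :
    ∃ v : K, ∃ x ∈ logSpan C (Set.univ : Set K), f = v′ + x := by
  classical
  have : CharZero K := charZero_of_injective_algebraMap (algebraMap C K).injective
  obtain ⟨E, _, _, _, _, hE, z, hz⟩ := hf
  obtain ⟨v, hv, x, hx, e⟩ := exists_mem_constTower_zero hE hz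
  obtain ⟨m, c, u, hu, rfl⟩ := exists_sum_of_mem_logSpan hx
  let _ : Algebra C E := ((algebraMap K E).comp (algebraMap C K)).toAlgebra
  have : IsScalarTower C K E := IsScalarTower.of_algebraMap_eq fun _ => rfl
  have hCE : ∀ c : C, (algebraMap C E c)′ = 0 := fun c => by
    rw [IsScalarTower.algebraMap_apply C K E, deriv_algebraMap, hC, map_zero]
  have hmem : ∀ x ∈ adjoin (constField E) (Set.range (algebraMap K E)),
      x ∈ adjoin K (constField E : Set E) := fun x hx => by
    induction hx using adjoin_induction with
    | mem x hx => obtain ⟨a, rfl⟩ := hx; exact IntermediateField.algebraMap_mem _ _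
    | algebraMap a => exact subset_adjoin _ _ a.2
    | add x y _ _ hx hy => exact add_mem hx hy
    | inv x _ hx => exact inv_mem hx
    | mul x y _ _ hx hy => exact mul_mem hx hy
  obtain ⟨T₀, hT₀, hvT₀⟩ := exists_finset_of_mem_adjoin (hmem v hv)
  choose T hT huT using fun j => exists_finset_of_mem_adjoin (hmem (u j) (hu j).1)
  -- Finitely many constants suffice to express `v`, all the `u j` and the coefficients `c j` over
  -- `K`.
  set S : Finset E := T₀ ∪ Finset.univ.biUnion T ∪ Finset.univ.image fun j => (c j : E) with hS
  have hSC : ∀ i : (S : Set E), (i : E)′ = 0 := by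
    rintro ⟨i, hi⟩
    simp only [hS, Finset.coe_union, Set.mem_union, Finset.coe_biUnion, Finset.coe_image,
      Set.mem_image, Set.mem_iUnion, Finset.mem_coe, Finset.mem_univ, true_and] at hi
    rcases hi with (hi | ⟨j, -, hi⟩) | ⟨j, -, rfl⟩
    · exact hT₀ hi
    · exact hT j hi
    · exact (c j).2
  have hfrac : ∀ y ∈ adjoin K (S : Set E), ∃ P Q : MvPolynomial (S : Set E) K,
      MvPolynomial.aeval (Subtype.val : ↥(S : Set E) → E) Q ≠ 0 ∧
      y = MvPolynomial.aeval (Subtype.val : ↥(S : Set E) → E) P /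
        MvPolynomial.aeval (Subtype.val : ↥(S : Set E) → E) Q := fun y hy => by
    obtain ⟨P, Q, rfl⟩ := (mem_adjoin_iff K y).1 hy
    by_cases hQ : MvPolynomial.aeval (Subtype.val : ↥(S : Set E) → E) Q = 0
    · exact ⟨0, 1, by simp, by rw [hQ]; simp⟩
    · exact ⟨P, Q, hQ, rfl⟩
  obtain ⟨P₀, Q₀, hQ₀, hv₀⟩ := hfrac v (adjoin.mono _ _ _ (by
    rw [hS]; push_cast; exact fun _ h => Or.inl (Or.inl h)) hvT₀)
  choose P Q hQ hPQ using fun j => hfrac (u j) (adjoin.mono _ _ _ (by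
    rw [hS]; push_cast
    exact fun _ h => Or.inl (Or.inr (Set.mem_iUnion₂.2 ⟨j, Set.mem_univ j, h⟩)))
    (huT j))
  have hP : ∀ j, MvPolynomial.aeval (Subtype.val : ↥(S : Set E) → E) (P j) ≠ 0 := fun j h =>
    (hu j).2 (by rw [hPQ, h, zero_div])
  -- The product keeps all denominators nonzero, and also the numerators of the `u j`, so that the
  -- logarithmic derivatives of the specialized `u j` make sense.
  obtain ⟨χ, hker, hχ⟩ := exists_specialization hconst hCE hSC (Q := Q₀ * ∏ j, (P j * Q j)) (by
    rw [map_mul, map_prod]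
    refine mul_ne_zero hQ₀ (Finset.prod_ne_zero_iff.2 fun j _ => ?_)
    rw [map_mul]
    exact mul_ne_zero (hP j) (hQ j))
  rw [map_mul, map_prod] at hχ
  have hχ' := fun j => Finset.prod_ne_zero_iff.1 (right_ne_zero_of_mul hχ) j (Finset.mem_univ j)
  simp only [map_mul] at hχ'
  set φ : MvPolynomial (S : Set E) K →+* E :=
    (MvPolynomial.aeval (Subtype.val : ↥(S : Set E) → E)).toRingHom with hφ
  set ψ : MvPolynomial (S : Set E) K →+* K :=
    (MvPolynomial.aeval fun i => algebraMap C K (χ i)).toRingHom with hψ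
  have hφD : ∀ P, (φ P)′ = φ (mvMapCoeffs P) := deriv_aeval_of_deriv_eq_zero hSC
  have hψD : ∀ P, (ψ P)′ = ψ (mvMapCoeffs P) :=
    deriv_aeval_of_deriv_eq_zero fun i => hC (χ i)
  have hv₁ : SpecializesTo φ ψ v (ψ P₀ / ψ Q₀) := ⟨P₀, Q₀, left_ne_zero_of_mul hχ, hv₀, rfl⟩
  have hu₁ : ∀ j, SpecializesTo φ ψ (u j) (ψ (P j) / ψ (Q j)) := fun j =>
    ⟨P j, Q j, right_ne_zero_of_mul (hχ' j), hPQ j, rfl⟩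
  have hu₂ : ∀ j, ψ (P j) / ψ (Q j) ≠ 0 := fun j =>
    div_ne_zero (left_ne_zero_of_mul (hχ' j)) (right_ne_zero_of_mul (hχ' j))
  have hcS : ∀ j, (c j : E) ∈ (S : Set E) := fun j => by
    rw [hS]; push_cast
    exact Or.inr ⟨j, Set.mem_univ j, rfl⟩
  have hc₁ : ∀ j, SpecializesTo φ ψ (c j : E) (algebraMap C K (χ ⟨c j, hcS j⟩)) := fun j => by
    have := SpecializesTo.of_ring (φ := φ) (ψ := ψ) (MvPolynomial.X ⟨c j, hcS j⟩)
    simpa [hφ, hψ] using this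
  have hf₁ : SpecializesTo φ ψ (algebraMap K E f) f := by
    have := SpecializesTo.of_ring (φ := φ) (ψ := ψ) (MvPolynomial.C f)
    simpa [hφ, hψ] using this
  have hR := (hv₁.deriv hker hφD hψD).add hker (SpecializesTo.sum hker (s := Finset.univ)
    fun j _ => (hc₁ j).mul (((hu₁ j).deriv hker hφD hψD).mul ((hu₁ j).inv (hu₂ j))))
  refine ⟨_, _, ?_, hf₁.unique hker (b := _) (by
    rw [e]
    convert hR using 3 with j
    rw [Algebra.smul_def, div_eq_mul_inv]
    rfl)⟩
  refine Submodule.sum_mem _ fun j _ => ?_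
  rw [← Algebra.smul_def, ← div_eq_mul_inv]
  exact Submodule.smul_mem _ _ (div_mem_logSpan (Set.mem_univ _) (hu₂ j))

end StrongLiouville

end DiffTower

namespace DiffTower
open Differential IntermediateField

/-! ### Adjoining logarithms -/

section LogarithmicExtension

/-- A derivation of a domain extends to its field of fractions. -/
lemma exists_differential_of_isFractionRing {A : Type*} [CommRing A] (D : A →+ A)
    (hD : ∀ a b, D (a * b) = a * D b + b * D a) (L : Type*) [Field L] [Algebra A L] [IsFractionRing A L] :
    ∃ _ : Differential L, ∀ a : A, (algebraMap A L a)′ = algebraMap A L (D a) := by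
  have hD1 : D 1 = 0 := by simpa using hD 1 1
  -- A derivation is a ring homomorphism `a ↦ a + D a ε` into the dual numbers. Nonzero elements of
  -- `A` become units there, so it extends to the fraction field.
  let g : A →+* TrivSqZeroExt L L :=
    { toFun := fun a =>
        TrivSqZeroExt.inl (algebraMap A L a) + TrivSqZeroExt.inr (algebraMap A L (D a))
      map_one' := TrivSqZeroExt.ext (by simp) (by simp [hD1])
      map_zero' := TrivSqZeroExt.ext (by simp) (by simp)
      map_add' := fun a b => TrivSqZeroExt.ext (by simp) (by simp [-DualNumber.inr_eq_smul_eps])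
      map_mul' := fun a b => TrivSqZeroExt.ext (by simp) (by
        simp [hD, -DualNumber.inr_eq_smul_eps, mul_comm]) }
  have hg : ∀ y : nonZeroDivisors A, IsUnit (g y) := fun y => by
    rw [TrivSqZeroExt.isUnit_iff_isUnit_fst]
    simpa [g] using IsLocalization.map_units L y
  let G : L →+* TrivSqZeroExt L L := IsLocalization.lift hg
  have hGA : ∀ a, G (algebraMap A L a) = g a := fun a => IsLocalization.lift_eq hg a
  have hfst : ∀ x, (G x).fst = x := fun x => by
    have : ((TrivSqZeroExt.fstHom L L L : TrivSqZeroExt L L →+* L).comp G) = RingHom.id L := by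
      refine IsLocalization.ringHom_ext (nonZeroDivisors A) (RingHom.ext fun a => ?_)
      change (G (algebraMap A L a)).fst = algebraMap A L a
      rw [hGA]; simp [g]
    exact RingHom.congr_fun this x
  refine ⟨⟨Derivation.mk' (AddMonoidHom.toIntLinearMap
    { toFun := fun x => (G x).snd
      map_zero' := by simp
      map_add' := fun x y => by simp }) fun x y => ?_⟩, fun a => ?_⟩
  · change (G (x * y)).snd = x • (G y).snd + y • (G x).snd
    rw [map_mul, TrivSqZeroExt.snd_mul, hfst, hfst, op_smul_eq_smul]
  · change (G (algebraMap A L a)).snd = _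
    rw [hGA]; simp [g, -DualNumber.inr_eq_smul_eps]

universe v

variable {K : Type v} [Field K] [Differential K]

/-- Finitely many logarithms can be adjoined to a differential field. -/
lemma exists_logarithms {m : ℕ} (u : Fin m → K) (hu : ∀ j, u j ≠ 0) :
    ∃ (E : Type v) (_ : Field E) (_ : Differential E) (_ : Algebra K E)
      (_ : DifferentialAlgebra K E) (θ : Fin m → E), IsElementaryExtension K E ∧
      ∀ j, (θ j)′ = algebraMap K E ((u j)′ / u j) := by
  let A := MvPolynomial (Fin m) K
  let D₁ : Derivation ℤ A A := mvMapCoeffs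
  -- The derivation on `K[X]` is the sum of `D₁`, acting on coefficients, and `D₂`, which prescribes
  -- `X_j′ = u_j′/u_j`.
  let D₂ : Derivation K A A := MvPolynomial.mkDerivation K fun j => MvPolynomial.C ((u j)′ / u j)
  let D : A →+ A := (D₁ : A →+ A) + (D₂ : A →+ A)
  have hDX : ∀ j, D (MvPolynomial.X j) = MvPolynomial.C ((u j)′ / u j) := fun j => by
    change mvMapCoeffs _ + MvPolynomial.mkDerivation K _ _ = _
    rw [mvMapCoeffs_X, MvPolynomial.mkDerivation_X, zero_add]
  have hDC : ∀ a, D (MvPolynomial.C a) = MvPolynomial.C a′ := fun a => by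
    change mvMapCoeffs _ + MvPolynomial.mkDerivation K _ _ = _
    rw [mvMapCoeffs_C, MvPolynomial.derivation_C, add_zero]
  obtain ⟨_, hd⟩ := exists_differential_of_isFractionRing D (fun a b => by
    change D₁ (a * b) + D₂ (a * b) = a * (D₁ b + D₂ b) + b * (D₁ a + D₂ a)
    rw [Derivation.leibniz, Derivation.leibniz]
    simp only [smul_eq_mul]
    ring) (FractionRing A)
  set E := FractionRing A
  have hA : ∀ a, algebraMap K E a = algebraMap A E (MvPolynomial.C a) := fun a =>
    IsScalarTower.algebraMap_apply K A E a
  have hX : ∀ j, (algebraMap A E (MvPolynomial.X j))′ = algebraMap K E ((u j)′ / u j) :=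
    fun j => by rw [hd, hDX, hA]
  refine ⟨E, inferInstance, inferInstance, inferInstance, ⟨fun a => ?_⟩,
    fun j => algebraMap A E (MvPolynomial.X j), ⟨m, fun i => if h : i < m then
      algebraMap A E (MvPolynomial.X ⟨i, h⟩) else 0, fun i hi => ?_, ?_⟩, hX⟩
  · rw [hA, hA, hd, hDC]
  · refine Or.inr (Or.inl ⟨algebraMap K _ (u ⟨i, hi⟩), by simpa using hu ⟨i, hi⟩, ?_⟩)
    change (dite _ _ _)′ = _
    rw [dif_pos hi, hX, ← IsScalarTower.algebraMap_apply, map_div₀, hA, hA, hd, hDC]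
  · rw [eq_top_iff]
    rintro x -
    obtain ⟨P, Q, hQ, rfl⟩ := IsFractionRing.div_surjective (A := A) x
    have hP : ∀ P : A, algebraMap A E P ∈ adjoin K ((fun i => if h : i < m then
        algebraMap A E (MvPolynomial.X ⟨i, h⟩) else 0) '' Set.Iio m) := fun P => by
      induction P using MvPolynomial.induction_on with
      | C a =>
        rw [← hA]
        exact IntermediateField.algebraMap_mem _ _
      | add P Q hP hQ => rw [map_add]; exact add_mem hP hQ
      | mul_X P i hP =>
        rw [map_mul]
        exact mul_mem hP (subset_adjoin _ _ ⟨i, i.2, by simp⟩)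
    exact div_mem (hP P) (hP Q)

lemma isElementarilyIntegrable_of_mem_logSpan {C : Type*} [Field C] [Algebra C K]
    (hC : ∀ c : C, (algebraMap C K c)′ = 0) {f a x : K}
    (hx : x ∈ logSpan C (Set.univ : Set K)) (e : f = a′ + x) : IsElementarilyIntegrable f := by
  obtain ⟨m, c, u, hu, rfl⟩ := exists_sum_of_mem_logSpan hx
  obtain ⟨E, _, _, _, _, θ, hE, hθ⟩ := exists_logarithms u fun j => (hu j).2
  refine ⟨E, _, _, _, ‹_›, hE, algebraMap K E a +
    ∑ j, algebraMap K E (algebraMap C K (c j)) * θ j, ?_⟩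
  rw [e, map_add, map_add, deriv_algebraMap, map_sum, map_sum]
  congr 1
  refine Finset.sum_congr rfl fun j _ => ?_
  rw [Derivation.leibniz, hθ, deriv_algebraMap, hC, Algebra.smul_def (c j), map_mul, map_zero, smul_zero,
    add_zero, smul_eq_mul]

end LogarithmicExtension

end DiffTower

namespace DiffTower
open Differential IntermediateField MvPolynomial

/-! ### Comparing coefficients of derivatives in several variables -/

section MvDeriv

variable {σ F K : Type*} [Field F] [Differential F] [Field K] [Differential K] [Algebra F K]
  [DifferentialAlgebra F K]

lemma deriv_aeval_of_mem_supported (x : σ → K) (J : Finset σ) {H : MvPolynomial σ F}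
    (hH : H ∈ supported F (J : Set σ)) :
    (aeval x H)′ = aeval x (mvMapCoeffs H) + ∑ j ∈ J, (x j)′ * aeval x (pderiv j H) := by
  classical
  rw [supported_eq_adjoin_X] at hH
  induction hH using Algebra.adjoin_induction with
  | mem P hP =>
    obtain ⟨i, hi, rfl⟩ := hP
    rw [aeval_X, mvMapCoeffs_X, map_zero, zero_add, Finset.sum_eq_single i]
    · simp
    · intro j _ hj
      rw [pderiv_X_of_ne hj.symm]; simp
    · exact fun h => absurd hi h
  | algebraMap a => simp [deriv_algebraMap]
  | add P Q _ _ hP hQ =>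
    simp only [map_add, hP, hQ, mul_add, Finset.sum_add_distrib]
    ring
  | mul P Q _ _ hP hQ =>
    simp only [map_mul, Derivation.leibniz, smul_eq_mul, map_add, hP, hQ, mul_add,
      Finset.sum_add_distrib, Finset.mul_sum]
    have e1 : ∀ A B : MvPolynomial σ F, ∑ j ∈ J, (x j)′ * (aeval x A * aeval x (pderiv j B)) =
        ∑ j ∈ J, aeval x A * ((x j)′ * aeval x (pderiv j B)) := fun A B =>
      Finset.sum_congr rfl fun j _ => by ring
    rw [e1, e1]
    ring

omit [Differential F] in
lemma mem_supported_iff {s : Set σ} {P : MvPolynomial σ F} :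
    P ∈ supported F s ↔ ∀ m, coeff m P ≠ 0 → ∀ j, m j ≠ 0 → j ∈ s := by
  rw [mem_supported]
  constructor
  · exact fun h m hm j hj => h (by
      rw [Finset.mem_coe, mem_vars_iff_mem_support]
      exact ⟨m, mem_support_iff.2 hm, Finsupp.mem_support_iff.2 hj⟩)
  · intro h j hj
    rw [Finset.mem_coe, mem_vars_iff_mem_support] at hj
    obtain ⟨m, hm, hj⟩ := hj
    exact h m (mem_support_iff.1 hm) j (Finsupp.mem_support_iff.1 hj)

/-- Comparison of coefficients in `P(x) = H(x)′ + c`. -/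
lemma algebraMap_coeff_eq {x : σ → K} {J : Finset σ}
    (hind : ∀ Q ∈ supported F (J : Set σ), aeval x Q = 0 → Q = 0)
    (hx : ∀ j ∈ J, (x j)′ ∈ (algebraMap F K).range) {P H : MvPolynomial σ F} {c : F}
    (hP : P ∈ supported F (J : Set σ)) (hH : H ∈ supported F (J : Set σ))
    (e : aeval x P = (aeval x H)′ + algebraMap F K c) (ν : σ →₀ ℕ) :
    algebraMap F K (coeff ν P) = (algebraMap F K (coeff ν H))′ +
      ∑ j ∈ J, (x j)′ * ((ν j + 1) * algebraMap F K (coeff (ν + Finsupp.single j 1) H)) +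
      algebraMap F K (coeff ν (C c : MvPolynomial σ F)) := by
  choose! η hη using hx
  -- `R` represents the right-hand side by the chain rule, and algebraic independence on `J`
  -- identifies it with `P`.
  set R : MvPolynomial σ F := mvMapCoeffs H + ∑ j ∈ J, C (η j) * pderiv j H + C c with hR
  have hcoeff : ∀ ν, coeff ν R = (coeff ν H)′ +
      ∑ j ∈ J, η j * (coeff (ν + Finsupp.single j 1) H * (ν j + 1)) +
      coeff ν (C c : MvPolynomial σ F) := fun ν => by
    simp only [hR, coeff_add, coeff_mvMapCoeffs, coeff_sum, coeff_C_mul, coeff_pderiv]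
  have hRs : R ∈ supported F (J : Set σ) := by
    rw [mem_supported_iff] at hH ⊢
    intro m hm j hj
    by_contra hjJ
    apply hm
    rw [hcoeff]
    have h1 : ∀ m' : σ →₀ ℕ, m' j ≠ 0 → coeff m' H = 0 := fun m' h => by
      by_contra h'
      exact hjJ (hH m' h' j h)
    classical
    rw [h1 m hj, map_zero, zero_add, coeff_C, if_neg (by rintro rfl; exact hj rfl), add_zero]
    refine Finset.sum_eq_zero fun i _ => ?_
    rw [h1 _ (by rw [Finsupp.add_apply]; omega)]
    simp
  have hPR : P = R := by
    refine sub_eq_zero.1 (hind _ (sub_mem hP hRs) ?_)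
    rw [map_sub, e, deriv_aeval_of_mem_supported x J hH, hR]
    simp only [map_add, map_sum, map_mul, aeval_C]
    rw [sub_eq_zero]
    congr 2
    exact Finset.sum_congr rfl fun j hj => by rw [hη j hj]
  rw [hPR, hcoeff, map_add, map_add, map_sum, deriv_algebraMap]
  congr 2
  refine Finset.sum_congr rfl fun j hj => ?_
  rw [← hη j hj]
  simp only [map_mul, map_add, map_natCast, map_one]
  ring

end MvDeriv

section Lex

/-- The variables with indices `a, …, b`. -/
def varRange (a b : ℕ) : Finset ℕᵒᵈ := (Finset.Icc a b).map OrderDual.toDual.toEmbedding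

lemma mem_varRange {a b : ℕ} {j : ℕᵒᵈ} :
    j ∈ varRange a b ↔ a ≤ OrderDual.ofDual j ∧ OrderDual.ofDual j ≤ b := by
  simp only [varRange, Finset.mem_map, Finset.mem_Icc]
  constructor
  · rintro ⟨i, hi, rfl⟩; exact hi
  · exact fun h => ⟨_, h, rfl⟩

open MonomialOrder

lemma lex_lt_add_single (ν : ℕᵒᵈ →₀ ℕ) (j : ℕᵒᵈ) :
    (lex (σ := ℕᵒᵈ)).toSyn ν < (lex (σ := ℕᵒᵈ)).toSyn (ν + Finsupp.single j 1) := by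
  refine MonomialOrder.toSyn_strictMono _ (lt_of_le_of_ne le_self_add fun h => ?_)
  have := congrArg (fun m : ℕᵒᵈ →₀ ℕ => m j) h
  simp at this

/-- In `ℕᵒᵈ` the relation `j < i` means that `j` has the larger index, hence is the larger variable.
-/
lemma lex_single_lt_single {i j : ℕᵒᵈ} (h : j < i) :
    (lex (σ := ℕᵒᵈ)).toSyn (Finsupp.single i 1) < (lex (σ := ℕᵒᵈ)).toSyn (Finsupp.single j 1) :=
  lex_lt_iff.2 (Finsupp.Lex.single_strictAnti h)

lemma lex_zero_le (ν : ℕᵒᵈ →₀ ℕ) :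
    (lex (σ := ℕᵒᵈ)).toSyn 0 ≤ (lex (σ := ℕᵒᵈ)).toSyn ν := by
  rw [map_zero]; exact MonomialOrder.zero_le _ _

/-- If some coefficient beyond `δ` has a property that `0` lacks, there is a largest one. -/
lemma exists_max_coeff {F : Type*} [Field F] (H : MvPolynomial ℕᵒᵈ F) (p : F → Prop) (hp : ¬ p 0)
    {ν : ℕᵒᵈ →₀ ℕ} (hν : p (coeff ν H)) :
    ∃ μ, (lex (σ := ℕᵒᵈ)).toSyn ν ≤ (lex (σ := ℕᵒᵈ)).toSyn μ ∧ p (coeff μ H) ∧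
      ∀ κ, (lex (σ := ℕᵒᵈ)).toSyn μ < (lex (σ := ℕᵒᵈ)).toSyn κ → ¬ p (coeff κ H) := by
  classical
  have hmem : ∀ κ, p (coeff κ H) → κ ∈ H.support.filter fun κ => p (coeff κ H) := fun κ hκ => by
    rw [Finset.mem_filter, mem_support_iff]
    exact ⟨fun h => hp (h ▸ hκ), hκ⟩
  obtain ⟨μ, hμ, hmax⟩ := Finset.exists_max_image _ (lex (σ := ℕᵒᵈ)).toSyn ⟨ν, hmem ν hν⟩
  exact ⟨μ, hmax ν (hmem ν hν), (Finset.mem_filter.1 hμ).2, fun κ hκ hpκ =>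
    absurd (hmax κ (hmem κ hpκ)) (not_le.2 hκ)⟩

end Lex

end DiffTower

namespace DiffTower
open Differential IntermediateField MvPolynomial

/-! ### The rings `K_k[t_{k+1}, …, t_n]` -/

section PolyRing

variable {C K : Type*} [Field C] [Field K] [Algebra C K] {t : ℕ → K} {n : ℕ}

/-- The point `(t_j)`, with variables indexed as in `IsFlatPoly`. -/
abbrev tpoint (t : ℕ → K) : ℕᵒᵈ → K := fun j => t (OrderDual.ofDual j)

variable (C t n) in
/-- The ring `K_k[t_{k+1}, …, t_n]`. -/
def polyRing (k : ℕ) : Subalgebra (tfield C t (k + 1)) K :=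
  Algebra.adjoin _ (t '' Set.Icc (k + 1) n)

omit [Field K] in
lemma tpoint_image_varRange (a b : ℕ) :
    tpoint t '' (varRange a b : Set ℕᵒᵈ) = t '' Set.Icc a b := by
  ext z
  constructor
  · rintro ⟨j, hj, rfl⟩
    exact ⟨_, mem_varRange.1 hj, rfl⟩
  · rintro ⟨j, hj, rfl⟩
    exact ⟨OrderDual.toDual j, mem_varRange.2 hj, rfl⟩

lemma mem_polyRing_iff {k : ℕ} {z : K} : z ∈ polyRing C t n k ↔
    ∃ H ∈ supported (tfield C t (k + 1)) (varRange (k + 1) n : Set ℕᵒᵈ),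
      aeval (tpoint t) H = z := by
  have : polyRing C t n k =
      (supported (tfield C t (k + 1)) (varRange (k + 1) n : Set ℕᵒᵈ)).map (aeval (tpoint t)) := by
    rw [supported_eq_adjoin_X, AlgHom.map_adjoin, polyRing, ← tpoint_image_varRange,
      Set.image_image]
    simp
  rw [this]; rfl

lemma aeval_mem_polyRing {i k : ℕ} (hik : i ≤ k)
    {P : MvPolynomial ℕᵒᵈ (tfield C t (i + 1))}
    (hP : P ∈ supported (tfield C t (i + 1)) (varRange (i + 1) n : Set ℕᵒᵈ)) :
    aeval (tpoint t) P ∈ polyRing C t n k := by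
  rw [supported_eq_adjoin_X] at hP
  induction hP using Algebra.adjoin_induction with
  | mem P hP =>
    obtain ⟨j, hj, rfl⟩ := hP
    rw [aeval_X]
    obtain ⟨-, h2⟩ := mem_varRange.1 hj
    by_cases h : OrderDual.ofDual j ≤ k
    · exact (polyRing C t n k).algebraMap_mem
        (⟨_, mem_tfield_self (by omega)⟩ : tfield C t (k + 1))
    · exact Algebra.subset_adjoin ⟨_, ⟨by omega, h2⟩, rfl⟩
  | algebraMap a =>
    rw [AlgHom.commutes]
    exact (polyRing C t n k).algebraMap_mem
      (⟨_, tfield_mono (by omega) a.2⟩ : tfield C t (k + 1))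
  | add P Q _ _ hP hQ => rw [map_add]; exact add_mem hP hQ
  | mul P Q _ _ hP hQ => rw [map_mul]; exact mul_mem hP hQ

/-- With `exists_coeff_mem_of_mem_polyRing` this describes `K_k[t_{k+1}, …, t_n]` inside
`K_{k+1}[t_{k+2}, …, t_n]` by the condition that coefficients lie in `K_k[t_{k+1}]`, as the descent
for flat polynomials requires. -/
lemma aeval_mem_polyRing_of_coeff_mem {k : ℕ} (hk : k + 1 ≤ n)
    {W : MvPolynomial ℕᵒᵈ (tfield C t (k + 1 + 1))}
    (hW : W ∈ supported (tfield C t (k + 1 + 1)) (varRange (k + 1 + 1) n : Set ℕᵒᵈ))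
    (hc : ∀ ν, algebraMap _ K (coeff ν W) ∈ Algebra.adjoin (tfield C t (k + 1)) {t (k + 1)}) :
    aeval (tpoint t) W ∈ polyRing C t n k := by
  rw [mem_supported_iff] at hW
  rw [aeval_def, eval₂_eq]
  refine sum_mem fun ν hν => mul_mem ?_ (prod_mem fun j hj => pow_mem ?_ _)
  · refine Algebra.adjoin_mono ?_ (hc ν)
    rintro _ rfl
    exact ⟨k + 1, ⟨le_rfl, hk⟩, rfl⟩
  · obtain ⟨h1, h2⟩ := mem_varRange.1 (hW ν (mem_support_iff.1 hν) j (Finsupp.mem_support_iff.1 hj))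
    exact Algebra.subset_adjoin ⟨_, ⟨by omega, h2⟩, rfl⟩

lemma exists_coeff_mem_of_mem_polyRing {k : ℕ} {z : K} (hz : z ∈ polyRing C t n k) :
    ∃ W ∈ supported (tfield C t (k + 1 + 1)) (varRange (k + 1 + 1) n : Set ℕᵒᵈ),
      aeval (tpoint t) W = z ∧
      ∀ ν, algebraMap _ K (coeff ν W) ∈ Algebra.adjoin (tfield C t (k + 1)) {t (k + 1)} := by
  classical
  have hC : ∀ c : tfield C t (k + 1 + 1),
      algebraMap _ K c ∈ Algebra.adjoin (tfield C t (k + 1)) {t (k + 1)} →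
      ∀ ν, algebraMap _ K (coeff ν (MvPolynomial.C c : MvPolynomial ℕᵒᵈ (tfield C t (k + 1 + 1)))) ∈
        Algebra.adjoin (tfield C t (k + 1)) {t (k + 1)} := fun c hc ν => by
    rw [coeff_C]
    split_ifs
    · exact hc
    · rw [map_zero]; exact zero_mem _
  induction hz using Algebra.adjoin_induction with
  | mem z hz =>
    obtain ⟨j, hj, rfl⟩ := hz
    rcases eq_or_lt_of_le hj.1 with rfl | h
    · refine ⟨MvPolynomial.C ⟨t (k + 1), mem_tfield_self (by omega)⟩,
        (supported _ _).algebraMap_mem _, by rw [aeval_C]; rfl, hC _ ?_⟩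
      exact Algebra.subset_adjoin rfl
    · refine ⟨X (OrderDual.toDual j), Algebra.subset_adjoin ?_, by rw [aeval_X]; rfl, fun ν => ?_⟩
      · exact ⟨_, mem_varRange.2 ⟨h, hj.2⟩, rfl⟩
      · rw [coeff_X]
        split_ifs <;> simp [one_mem, zero_mem]
  | algebraMap a =>
    refine ⟨MvPolynomial.C ⟨_, tfield_mono (by omega) a.2⟩,
        (supported _ _).algebraMap_mem _, by rw [aeval_C]; rfl, hC _ ?_⟩
    exact (Algebra.adjoin (tfield C t (k + 1)) {t (k + 1)}).algebraMap_mem a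
  | add z z' _ _ h h' =>
    obtain ⟨W, hW, rfl, hc⟩ := h
    obtain ⟨W', hW', rfl, hc'⟩ := h'
    refine ⟨W + W', add_mem hW hW', map_add _ _ _, fun ν => ?_⟩
    rw [coeff_add, map_add]
    exact add_mem (hc ν) (hc' ν)
  | mul z z' _ _ h h' =>
    obtain ⟨W, hW, rfl, hc⟩ := h
    obtain ⟨W', hW', rfl, hc'⟩ := h'
    refine ⟨W * W', mul_mem hW hW', map_mul _ _ _, fun ν => ?_⟩
    rw [coeff_mul, map_sum]
    exact sum_mem fun _ _ => by rw [map_mul]; exact mul_mem (hc _) (hc' _)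

variable [Differential K] [CharZero C]

lemma IsPrimitiveTower.algebraicIndepOn (h : IsPrimitiveTower C n t) {k N : ℕ} (hk : k ≤ N)
    (hN : N ≤ n) :
    AlgebraicIndepOn (tfield C t (k + 1)) (tpoint t) (varRange (k + 1) N : Set ℕᵒᵈ) := by
  induction N, hk using Nat.le_induction with
  | base =>
    have : IsEmpty (varRange (k + 1) k : Set ℕᵒᵈ) :=
      ⟨fun j => by have := mem_varRange.1 j.2; omega⟩
    exact algebraicIndependent_empty_type
  | succ N hkN ih =>
    have hins : (varRange (k + 1) (N + 1) : Set ℕᵒᵈ) =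
        insert (OrderDual.toDual (N + 1)) (varRange (k + 1) N : Set ℕᵒᵈ) := by
      ext j
      rw [Set.mem_insert_iff, Finset.mem_coe, Finset.mem_coe, mem_varRange, mem_varRange]
      have : j = OrderDual.toDual (N + 1) ↔ OrderDual.ofDual j = N + 1 := Iff.rfl
      rw [this]
      omega
    rw [hins]
    refine (ih (by omega)).insert ?_
    obtain ⟨_, _, _, η, ht⟩ := h.exists_differential hN
    rw [tpoint_image_varRange]
    have hle : ∀ z ∈ Algebra.adjoin (tfield C t (k + 1)) (t '' Set.Icc (k + 1) N),
        z ∈ tfield C t (N + 1) := fun z hz => by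
      induction hz using Algebra.adjoin_induction with
      | mem z hz =>
        obtain ⟨j, hj, rfl⟩ := hz
        exact mem_tfield_self (by have := hj.2; omega)
      | algebraMap a => exact tfield_mono (by omega) a.2
      | add _ _ _ _ h h' => exact add_mem h h'
      | mul _ _ _ _ h h' => exact mul_mem h h'
    intro halg
    let i : Algebra.adjoin (tfield C t (k + 1)) (t '' Set.Icc (k + 1) N) →+* tfield C t (N + 1) :=
      { toFun := fun x => ⟨x, hle _ x.2⟩
        map_one' := rfl
        map_zero' := rfl
        map_add' := fun _ _ => rfl
        map_mul' := fun _ _ => rfl }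
    let _ := i.toAlgebra
    have : IsScalarTower (Algebra.adjoin (tfield C t (k + 1)) (t '' Set.Icc (k + 1) N))
      (tfield C t (N + 1)) K := IsScalarTower.of_algebraMap_eq fun _ => rfl
    have hi : Function.Injective i := fun a b hab => 
      Subtype.ext (congrArg (Subtype.val : tfield C t (N + 1) → K) hab)
    exact ht.transcendental (halg.extendScalars hi)

lemma IsPrimitiveTower.eq_zero_of_aeval_eq_zero (h : IsPrimitiveTower C n t) {k : ℕ} (hk : k ≤ n)
    {Q : MvPolynomial ℕᵒᵈ (tfield C t (k + 1))}
    (hQ : Q ∈ supported (tfield C t (k + 1)) (varRange (k + 1) n : Set ℕᵒᵈ))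
    (e : aeval (tpoint t) Q = 0) : Q = 0 := by
  rw [supported_eq_range_rename] at hQ
  obtain ⟨R, rfl⟩ := hQ
  have e' : aeval (tpoint t ∘ Subtype.val) R = 0 := by rw [← aeval_rename]; exact e
  have hR : R = 0 := h.algebraicIndepOn hk le_rfl (by rw [map_zero]; exact e')
  rw [hR, map_zero]

end PolyRing

/-! ### The flat case -/

section Flat

variable {C K : Type*} [Field C] [CharZero C] [Field K] [Differential K] [Algebra C K]
  {t : ℕ → K} {n : ℕ}

omit [CharZero C] in
lemma DerivClosed.mem_of_mem_logSpan {F : IntermediateField C K} (hF : DerivClosed F) {x : K}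
    (hx : x ∈ logSpan C (F : Set K)) : x ∈ F := by
  induction hx using Submodule.span_induction with
  | mem x hx => obtain ⟨a, ha, -, rfl⟩ := hx; exact div_mem (hF a ha) ha
  | zero => exact zero_mem _
  | add x y _ _ hx hy => exact add_mem hx hy
  | smul c x _ hx => exact F.smul_mem hx

omit [CharZero C] in
lemma logSpan_eq_zero {S : Set K} (hS : ∀ a ∈ S, a′ = 0) {x : K} (hx : x ∈ logSpan C S) :
    x = 0 := by
  induction hx using Submodule.span_induction with
  | mem x hx => obtain ⟨a, ha, -, rfl⟩ := hx; rw [hS a ha, zero_div]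
  | zero => rfl
  | add x y _ _ hx hy => rw [hx, hy, add_zero]
  | smul c x _ hx => rw [hx, smul_zero]

/-- An element of `K_0` has degree `0` in `t_{k+1}`, so its simple part there vanishes and it
descends one level. At `K_0` the part coming from `C` vanishes, which leaves a `t_0`-simple element.
Applied to the `t_j′`. -/
lemma IsPrimitiveTower.isSimple_of_mem_logSpan (h : IsPrimitiveTower C n t) {k : ℕ} (hk : k ≤ n)
    {x : K} (hx : x ∈ logSpan C (tfield C t (k + 1) : Set K)) (hx1 : x ∈ tfield C t 1) :
    x ∈ logSpan C (tfield C t 1 : Set K) ∧ IsSimple (tfield C t 0) (t 0) x := by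
  induction k generalizing x with
  | zero =>
    refine ⟨hx, ?_⟩
    obtain ⟨_, _, _, η, ht⟩ := h.exists_differential (m := 0) (by omega)
    rw [← tfield_subset_iff] at hx
    obtain ⟨s, y, hy, hs, -, rfl⟩ := exists_isSimple_of_mem_logSpan ht hx
    have hy' : algebraMap (tfield C t 0) K y ∈ logSpan C (tfield C t 0 : Set K) :=
      algebraMap_mem_logSpan (fun a _ => a.2) hy
    rwa [logSpan_eq_zero (fun a ha => ?_) hy', add_zero]
    obtain ⟨c, rfl⟩ := mem_tfield_zero_iff.1 ha
    exact h.deriv_const c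
  | succ k ih =>
    obtain ⟨_, _, _, η, ht⟩ := h.exists_differential hk
    rw [← tfield_subset_iff] at hx
    obtain ⟨s, y, hy, hs, -, rfl⟩ := exists_isSimple_of_mem_logSpan ht hx
    have hs0 := hs.isProper.eq_zero_of_eq_aeval ht.transcendental
      (P := Polynomial.C (⟨_, tfield_mono (by omega) hx1⟩ - y)) (by simp)
    have hs0 : s = 0 := by
      have : s = Polynomial.aeval (t (k + 1))
        (Polynomial.C ((⟨_, tfield_mono (by omega) hx1⟩ : tfield C t (k + 1)) - y)) := by simp
      rw [this, hs0, map_zero]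
    subst hs0
    rw [zero_add] at hx1 ⊢
    exact ih (by omega) (algebraMap_mem_logSpan (fun a _ => a.2) hy) hx1

/-- One descending step for flat polynomials. -/
lemma mem_logSpan_of_isSimple_headCoeff (h : IsPrimitiveTower C n t) (hflat : IsFlatTower C n t)
    {k : ℕ} (hk : k + 1 ≤ n) {P : MvPolynomial ℕᵒᵈ (tfield C t (k + 1 + 1))}
    (hP : P ∈ supported (tfield C t (k + 1 + 1)) (varRange (k + 1 + 1) n : Set ℕᵒᵈ))
    (hhc : IsSimple (tfield C t (k + 1)) (t (k + 1)) (algebraMap _ K (headCoeff P)))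
    {q v x : K} (hq : q ∈ polyRing C t n k) (hv : v ∈ polyRing C t n (k + 1))
    (hx : x ∈ logSpan C (tfield C t (k + 1 + 1) : Set K))
    (e : aeval (tpoint t) P + q = v′ + x) :
    aeval (tpoint t) P ∈ logSpan C (Set.univ : Set K) ∧ ∃ w ∈ polyRing C t n k,
      ∃ y ∈ logSpan C (tfield C t (k + 1) : Set K), q = w′ + y := by
  classical
  obtain ⟨H, hH, rfl⟩ := mem_polyRing_iff.1 hv
  obtain ⟨W, hW, rfl, hWc⟩ := exists_coeff_mem_of_mem_polyRing hq
  have hxF := (h.derivClosed (by omega)).mem_of_mem_logSpan hx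
  obtain ⟨_, _, _, η, ht⟩ := h.exists_differential hk
  let _ := (h.derivClosed (by omega : k + 1 + 1 ≤ n + 1)).differential
  have : DifferentialAlgebra (tfield C t (k + 1 + 1)) K :=
    (h.derivClosed (by omega : k + 1 + 1 ≤ n + 1)).differentialAlgebra
  rw [← tfield_subset_iff] at hx
  obtain ⟨s, y, hy, hs, hsl, rfl⟩ := exists_isSimple_of_mem_logSpan ht hx
  have hyl : algebraMap (tfield C t (k + 1)) K y ∈ logSpan C (tfield C t (k + 1) : Set K) :=
    algebraMap_mem_logSpan (fun a _ => a.2) hy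
  set R := Algebra.adjoin (tfield C t (k + 1)) {t (k + 1)} with hR
  have hRmem : ∀ z, z ∈ R → ∃ Q : Polynomial (tfield C t (k + 1)),
      z = Polynomial.aeval (t (k + 1)) Q := fun z hz => by
    rw [hR, Algebra.adjoin_singleton_eq_range_aeval] at hz
    obtain ⟨Q, rfl⟩ := hz
    exact ⟨Q, rfl⟩
  have hdR : ∀ z ∈ R, z′ ∈ R := fun z hz => by
    obtain ⟨Q, rfl⟩ := hRmem z hz
    rw [ht.deriv_aeval]
    exact Polynomial.aeval_mem_adjoin_singleton _ _
  -- an element of `R` which is simple vanishes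
  have hR0 : ∀ z ∈ R, IsSimple (tfield C t (k + 1)) (t (k + 1)) z → z = 0 := fun z hz hz' => by
    obtain ⟨Q, rfl⟩ := hRmem z hz
    rw [hz'.isProper.eq_zero_of_eq_aeval ht.transcendental rfl, map_zero]
  set J := varRange (k + 1 + 1) n with hJ
  have hη : ∀ j ∈ J, (tpoint t j)′ ∈ tfield C t 1 := fun j hj => by
    obtain ⟨h1, h2⟩ := mem_varRange.1 hj
    exact hflat _ (by omega) h2
  have hcoeff := algebraMap_coeff_eq (x := tpoint t) (J := J)
    (fun Q hQ e => h.eq_zero_of_aeval_eq_zero (by omega) hQ e)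
    (fun j hj => ⟨⟨_, tfield_mono (by omega) (hη j hj)⟩, rfl⟩)
    (P := P + W) (c := ⟨_, hxF⟩) (add_mem hP hW) hH (by rw [map_add, e]; rfl)
  have hyR : algebraMap (tfield C t (k + 1)) K y ∈ R := R.algebraMap_mem y
  -- Modulo `R = K_k[t_{k+1}]`, the term `x = s + y` contributes only `s`, and only at the monomial
  -- `1`.
  have hCR : ∀ ν, algebraMap _ K (coeff ν (MvPolynomial.C (⟨_, hxF⟩ : tfield C t (k + 1 + 1)) :
      MvPolynomial ℕᵒᵈ (tfield C t (k + 1 + 1)))) - (if ν = 0 then s else 0) ∈ R := fun ν => by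
    rw [coeff_C]
    by_cases h0 : ν = 0
    · rw [if_pos h0.symm, if_pos h0]
      convert hyR using 1
      exact add_sub_cancel_left _ _
    · rw [if_neg (Ne.symm h0), if_neg h0]
      simp [zero_mem]
  -- beyond a monomial where all coefficients of `H` lie in `R`
  have hstep : ∀ ν, (∀ κ, (MonomialOrder.lex (σ := ℕᵒᵈ)).toSyn ν <
      (MonomialOrder.lex (σ := ℕᵒᵈ)).toSyn κ → algebraMap _ K (coeff κ H) ∈ R) →
      algebraMap _ K (coeff ν P) - (if ν = 0 then s else 0) - (algebraMap _ K (coeff ν H))′ ∈ R := by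
    intro ν hν
    have h1 : ∑ j ∈ J, (tpoint t j)′ * ((ν j + 1) *
        algebraMap _ K (coeff (ν + Finsupp.single j 1) H)) ∈ R := by
      refine sum_mem fun j hj => mul_mem ?_ (mul_mem (add_mem (natCast_mem _ _) (one_mem _))
        (hν _ (lex_lt_add_single ν j)))
      exact R.algebraMap_mem (⟨_, tfield_mono (by omega) (hη j hj)⟩ : tfield C t (k + 1))
    have h2 := hcoeff ν
    rw [coeff_add, map_add] at h2
    have h3 := sub_mem (add_mem h1 (hCR ν)) (hWc ν)
    convert h3 using 1
    linear_combination h2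
  set δ := (MonomialOrder.lex (σ := ℕᵒᵈ)).degree P with hδ
  have hPlt : ∀ κ, (MonomialOrder.lex (σ := ℕᵒᵈ)).toSyn δ <
      (MonomialOrder.lex (σ := ℕᵒᵈ)).toSyn κ → coeff κ P = 0 := fun κ hκ =>
    MonomialOrder.coeff_eq_zero_of_lt hκ
  have hsimp : ∀ ν, (MonomialOrder.lex (σ := ℕᵒᵈ)).toSyn δ ≤
      (MonomialOrder.lex (σ := ℕᵒᵈ)).toSyn ν → IsSimple (tfield C t (k + 1)) (t (k + 1))
        (algebraMap _ K (coeff ν P) - (if ν = 0 then s else 0)) := fun ν hν => by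
    rw [sub_eq_add_neg]
    refine IsSimple.add ht.transcendental ?_ (isSimple_neg ht ?_)
    · rcases eq_or_lt_of_le hν with h' | h'
      · rw [← (MonomialOrder.lex (σ := ℕᵒᵈ)).toSyn.injective h']; exact hhc
      · rw [hPlt ν h', map_zero]; exact isSimple_zero
    · split_ifs
      · exact hs
      · exact isSimple_zero
  -- if the coefficients beyond `δ` lie in `R`, then `P = s`
  have hend : (∀ κ, (MonomialOrder.lex (σ := ℕᵒᵈ)).toSyn δ <
      (MonomialOrder.lex (σ := ℕᵒᵈ)).toSyn κ → algebraMap _ K (coeff κ H) ∈ R) →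
      algebraMap _ K (coeff δ H) ∈ R → δ = 0 ∧ algebraMap _ K (coeff δ P) = s := by
    intro hκ hδR
    have h1 := hR0 _ (by simpa using add_mem (hstep δ hκ) (hdR _ hδR)) (hsimp δ le_rfl)
    by_cases h0 : δ = 0
    · rw [if_pos h0, sub_eq_zero] at h1
      exact ⟨h0, h1⟩
    · rw [if_neg h0, sub_zero, _root_.map_eq_zero] at h1
      have hP0 : P = 0 := (MonomialOrder.lex (σ := ℕᵒᵈ)).leadingCoeff_eq_zero_iff.1 h1
      exact absurd (by rw [hδ, hP0]; simp) h0
  -- At the largest monomial where `H` has a coefficient outside `R`, the derivative of that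
  -- coefficient is a simple element modulo `R`, so by Hermite reduction the coefficient lies in `R`
  -- after all. Below `δ` this situation cannot occur, since `hend` would give `δ = 0`.
  have hHR : ∀ ν, algebraMap _ K (coeff ν H) ∈ R := by
    by_contra! hcon
    obtain ⟨ν, hν⟩ := hcon
    obtain ⟨μ, -, hμ, hmax⟩ := exists_max_coeff H (fun z => algebraMap _ K z ∉ R)
      (by simp [zero_mem]) hν
    simp only [not_not] at hmax
    have hsμ : IsSimple (tfield C t (k + 1)) (t (k + 1))
        (algebraMap _ K (coeff μ P) - (if μ = 0 then s else 0)) := by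
      rcases le_or_gt ((MonomialOrder.lex (σ := ℕᵒᵈ)).toSyn δ)
        ((MonomialOrder.lex (σ := ℕᵒᵈ)).toSyn μ) with hle | hlt
      · exact hsimp μ hle
      · obtain ⟨h0, -⟩ := hend (fun κ hκ => hmax κ (hlt.trans hκ)) (hmax δ hlt)
        rw [h0] at hlt
        exact absurd hlt (not_lt.2 (lex_zero_le μ))
    obtain ⟨Q, hQ⟩ := hRmem _ (hstep μ hmax)
    obtain ⟨-, H', hH', -⟩ := eq_zero_of_isSimple_add_aeval_eq_deriv ht hsμ
      (mem_adjoin_tfield_iff.2 (coeff μ H).2) (P := -Q)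
      (h := algebraMap _ K (coeff μ H)) (by rw [map_neg]; linear_combination hQ)
    exact hμ (by rw [hH']; exact Polynomial.aeval_mem_adjoin_singleton _ _)
  obtain ⟨h0, hs'⟩ := hend (fun κ _ => hHR κ) (hHR δ)
  have hPs : aeval (tpoint t) P = s := by
    rw [MonomialOrder.eq_C_of_degree_eq_zero h0, aeval_C]
    exact hs'
  refine ⟨hPs ▸ logSpan_mono (Set.subset_univ _) hsl, _,
    aeval_mem_polyRing_of_coeff_mem hk hH hHR, _, hyl, ?_⟩
  rw [hPs] at e
  linear_combination e

/-- The sum of the `d j • t_j` is then a constant, hence in `C`, and the `t_j` are algebraically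
independent over `K_0`. -/
lemma IsPrimitiveTower.eq_zero_of_sum_smul_deriv_eq_zero (h : IsPrimitiveTower C n t)
    {d : ℕᵒᵈ → C} (e : ∑ j ∈ varRange 1 n, d j • (tpoint t j)′ = 0) {j : ℕᵒᵈ}
    (hj : j ∈ varRange 1 n) : d j = 0 := by
  classical
  have e' : (∑ j ∈ varRange 1 n, d j • tpoint t j)′ = 0 := by
    rw [map_sum, ← e]
    exact Finset.sum_congr rfl fun j _ => deriv_smul h.deriv_const _ _
  obtain ⟨c, hc⟩ := h.exists_eq_of_deriv_eq_zero le_rfl (by rw [h.top]; trivial) e'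
  set Q : MvPolynomial ℕᵒᵈ (tfield C t (0 + 1)) :=
    ∑ j ∈ varRange 1 n, MvPolynomial.C (algebraMap C _ (d j)) * X j -
      MvPolynomial.C (algebraMap C _ c) with hQ
  have hQ0 : Q = 0 := by
    refine h.eq_zero_of_aeval_eq_zero (Nat.zero_le n) (sub_mem (sum_mem fun j hj =>
      mul_mem ((supported _ _).algebraMap_mem _) (Algebra.subset_adjoin ⟨j, hj, rfl⟩))
      ((supported _ _).algebraMap_mem _)) ?_
    rw [hQ, map_sub, map_sum, sub_eq_zero, aeval_C]
    rw [show algebraMap (tfield C t (0 + 1)) K (algebraMap C _ c) = algebraMap C K c from rfl, hc]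
    refine Finset.sum_congr rfl fun j _ => ?_
    rw [map_mul, aeval_C, aeval_X, Algebra.smul_def]
    rfl
  have h1 := congrArg (coeff (Finsupp.single j 1)) hQ0
  rw [hQ, coeff_sub, coeff_sum, coeff_C, if_neg (by
    intro h0
    have := congrArg (fun m : ℕᵒᵈ →₀ ℕ => m j) h0
    simp at this), Finset.sum_eq_single j (fun i _ hi => by
      rw [coeff_C_mul, coeff_X, if_neg (fun h0 => hi (Finsupp.single_left_injective one_ne_zero h0)),
        mul_zero]) (fun h0 => absurd hj h0), coeff_C_mul, coeff_X, if_pos rfl] at h1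
  simpa using h1

/-- The base step for flat polynomials. -/
lemma mem_logSpan_of_isFlatRigid (h : IsPrimitiveTower C n t) (hn : 1 ≤ n)
    (hflat : IsFlatTower C n t)
    (hlog : ∀ i, 1 ≤ i → i ≤ n → (t i)′ ∈ logSpan C (tfield C t i : Set K))
    {P : MvPolynomial ℕᵒᵈ (tfield C t (0 + 1))}
    (hP : P ∈ supported (tfield C t (0 + 1)) (varRange (0 + 1) n : Set ℕᵒᵈ))
    (hr : IsFlatRigid C t (scale n P) (algebraMap _ K (headCoeff P)))
    {v x : K} (hv : v ∈ polyRing C t n 0) (hx : x ∈ logSpan C (tfield C t (0 + 1) : Set K))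
    (e : aeval (tpoint t) P = v′ + x) :
    aeval (tpoint t) P ∈ logSpan C (Set.univ : Set K) := by
  classical
  have hxF := (h.derivClosed (by omega)).mem_of_mem_logSpan hx
  obtain ⟨-, hxs⟩ := h.isSimple_of_mem_logSpan (Nat.zero_le n) hx hxF
  obtain ⟨H, hH, rfl⟩ := mem_polyRing_iff.1 hv
  obtain ⟨_, _, _, η, ht⟩ := h.exists_differential (Nat.zero_le n)
  let _ := (h.derivClosed (by omega : 0 + 1 ≤ n + 1)).differential
  have : DifferentialAlgebra (tfield C t (0 + 1)) K :=
    (h.derivClosed (by omega : 0 + 1 ≤ n + 1)).differentialAlgebra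
  set J := varRange (0 + 1) n with hJ
  have hη : ∀ j ∈ J, (tpoint t j)′ ∈ logSpan C (tfield C t 1 : Set K) ∧
      IsSimple (tfield C t 0) (t 0) (tpoint t j)′ ∧ (tpoint t j)′ ∈ tfield C t 1 := fun j hj => by
    obtain ⟨h1, h2⟩ := mem_varRange.1 hj
    have h3 := hflat _ (by omega) h2
    obtain ⟨i, hi⟩ : ∃ i, OrderDual.ofDual j = i + 1 := ⟨OrderDual.ofDual j - 1, by omega⟩
    have h4 := h.isSimple_of_mem_logSpan (k := i) (by omega) (hi ▸ hlog _ (by omega) h2) h3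
    exact ⟨h4.1, h4.2, h3⟩
  have hcoeff := algebraMap_coeff_eq (x := tpoint t) (J := J)
    (fun Q hQ e => h.eq_zero_of_aeval_eq_zero (Nat.zero_le n) hQ e)
    (fun j hj => ⟨⟨_, (hη j hj).2.2⟩, rfl⟩) (c := ⟨_, hxF⟩) hP hH e
  have hconst : ∀ w : tfield C t (0 + 1), IsSimple (tfield C t 0) (t 0) (algebraMap _ K w)′ →
      ∃ c : C, algebraMap C K c = algebraMap _ K w := fun w hw => by
    obtain ⟨h0, -⟩ := eq_zero_of_isSimple_add_aeval_eq_deriv ht hw (P := 0)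
      (mem_adjoin_tfield_iff.2 w.2) (by rw [map_zero, add_zero]; rfl)
    exact h.exists_eq_of_deriv_eq_zero (by omega) w.2 h0
  have hsmul : ∀ (c : C) {z : K}, IsSimple (tfield C t 0) (t 0) z →
      IsSimple (tfield C t 0) (t 0) (c • z) := fun c z hz => by
    rw [← IsScalarTower.algebraMap_smul (tfield C t 0) c z, Algebra.smul_def]
    exact hz.algebraMap_mul ht.transcendental _
  have hsum : ∀ d : ℕᵒᵈ → C, IsSimple (tfield C t 0) (t 0) (∑ j ∈ J, d j • (tpoint t j)′) :=
    fun d => Finset.sum_induction _ _ (fun _ _ => IsSimple.add ht.transcendental) isSimple_zero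
      fun j hj => hsmul _ (hη j hj).2.1
  set δ := (MonomialOrder.lex (σ := ℕᵒᵈ)).degree P with hδ
  rcases hr with h0 | ⟨hrs, hrspan⟩
  · rw [_root_.map_eq_zero] at h0
    rw [(MonomialOrder.lex (σ := ℕᵒᵈ)).leadingCoeff_eq_zero_iff.1 h0, map_zero]
    exact zero_mem _
  -- rewriting of the coefficient equation where the higher coefficients of `H` are constant
  have hsmuls : ∀ ν, (∀ κ, (MonomialOrder.lex (σ := ℕᵒᵈ)).toSyn ν <
      (MonomialOrder.lex (σ := ℕᵒᵈ)).toSyn κ → ∃ c : C, algebraMap C K c = algebraMap _ K (coeff κ H)) →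
      ∃ d : ℕᵒᵈ → C, (∀ j, algebraMap C K (d j) =
        (ν j + 1) * algebraMap _ K (coeff (ν + Finsupp.single j 1) H)) ∧
        algebraMap _ K (coeff ν P) = (algebraMap _ K (coeff ν H))′ +
          ∑ j ∈ J, d j • (tpoint t j)′ + algebraMap _ K (coeff ν (MvPolynomial.C
            (⟨_, hxF⟩ : tfield C t (0 + 1)) : MvPolynomial ℕᵒᵈ (tfield C t (0 + 1)))) := by
    intro ν hν
    choose d hd using fun j => hν _ (lex_lt_add_single ν j)
    have hd' : ∀ j, algebraMap C K ((ν j + 1) * d j) =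
        (ν j + 1) * algebraMap _ K (coeff (ν + Finsupp.single j 1) H) := fun j => by
      rw [map_mul, hd, map_add, map_natCast, map_one]
    refine ⟨fun j => (ν j + 1) * d j, hd', ?_⟩
    rw [hcoeff ν]
    congr 2
    refine Finset.sum_congr rfl fun j _ => ?_
    rw [Algebra.smul_def, hd', mul_comm]
  have hC0 : ∀ ν : ℕᵒᵈ →₀ ℕ, ν ≠ 0 → coeff ν (MvPolynomial.C
      (⟨_, hxF⟩ : tfield C t (0 + 1)) : MvPolynomial ℕᵒᵈ (tfield C t (0 + 1))) = 0 := fun ν hν => by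
    rw [coeff_C, if_neg (Ne.symm hν)]
  have hne : ∀ {ν}, (MonomialOrder.lex (σ := ℕᵒᵈ)).toSyn δ <
      (MonomialOrder.lex (σ := ℕᵒᵈ)).toSyn ν → ν ≠ 0 := fun hν h0 => by
    rw [h0] at hν
    exact not_lt.2 (lex_zero_le δ) hν
  have hPlt : ∀ κ, (MonomialOrder.lex (σ := ℕᵒᵈ)).toSyn δ <
      (MonomialOrder.lex (σ := ℕᵒᵈ)).toSyn κ → coeff κ P = 0 := fun κ hκ =>
    MonomialOrder.coeff_eq_zero_of_lt hκ
  -- Beyond `δ` the polynomial `P` vanishes. At the largest nonconstant coefficient of `H` there,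
  -- its derivative is a combination of the simple elements `t_j′`, so `hconst` makes it constant.
  have hHc : ∀ ν, (MonomialOrder.lex (σ := ℕᵒᵈ)).toSyn δ <
      (MonomialOrder.lex (σ := ℕᵒᵈ)).toSyn ν →
      ∃ c : C, algebraMap C K c = algebraMap _ K (coeff ν H) := by
    by_contra! hcon
    obtain ⟨ν, hν, hνc⟩ := hcon
    obtain ⟨μ, hνμ, hμ, hmax⟩ := exists_max_coeff H
      (fun z => ∀ c : C, algebraMap C K c ≠ algebraMap _ K z)
      (by push Not; exact ⟨0, by simp⟩) hνc
    push Not at hmax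
    obtain ⟨d, -, hd⟩ := hsmuls μ hmax
    have hδμ := hν.trans_le hνμ
    rw [hPlt μ hδμ, hC0 μ (hne hδμ), map_zero, add_zero] at hd
    obtain ⟨c, hc⟩ := hconst (coeff μ H) (by
      rw [eq_neg_of_add_eq_zero_left hd.symm]
      exact isSimple_neg ht (hsum d))
    exact hμ c hc
  obtain ⟨d, hd, hdδ⟩ := hsmuls δ hHc
  have hHδ : (algebraMap _ K (coeff δ H))′ = 0 := by
    obtain ⟨c, hc⟩ := hconst (coeff δ H) (by
      have : (algebraMap _ K (coeff δ H))′ = algebraMap _ K (coeff δ P) +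
          (-(∑ j ∈ J, d j • (tpoint t j)′) + -algebraMap _ K (coeff δ (MvPolynomial.C
            (⟨_, hxF⟩ : tfield C t (0 + 1)) : MvPolynomial ℕᵒᵈ (tfield C t (0 + 1))))) := by
        rw [hdδ]; ring
      rw [this]
      refine IsSimple.add ht.transcendental hrs (IsSimple.add ht.transcendental
        (isSimple_neg ht (hsum d)) (isSimple_neg ht ?_))
      rw [coeff_C]
      split_ifs
      · exact hxs
      · rw [map_zero]; exact isSimple_zero)
    rw [← hc, h.deriv_const]
  rw [hHδ, zero_add (∑ j ∈ J, d j • (tpoint t j)′)] at hdδ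
  -- If the head monomial is `1`, then `P` is the constant `∑ d_j t_j′ + x`. Otherwise its head
  -- coefficient is `∑ d_j t_j′`, and showing `d_j = 0` for `j > s` contradicts `s`-rigidity.
  by_cases hδ0 : δ = 0
  · rw [MonomialOrder.eq_C_of_degree_eq_zero hδ0, aeval_C]
    change algebraMap _ K (coeff δ P) ∈ _
    rw [hdδ]
    refine add_mem (sum_mem fun j hj => Submodule.smul_mem _ _
      (logSpan_mono (Set.subset_univ _) (hη j hj).1)) ?_
    rw [coeff_C]
    split_ifs
    · exact logSpan_mono (Set.subset_univ _) hx
    · rw [map_zero]; exact zero_mem _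
  exfalso
  refine hrspan ?_
  change algebraMap _ K (coeff δ P) ∈ _
  have hscale : scale n P = sInf {j : ℕ | δ (OrderDual.toDual j) ≠ 0} := if_neg hδ0
  have hs : δ (OrderDual.toDual (scale n P)) ≠ 0 := by
    rw [hscale]
    refine Nat.sInf_mem (s := {j : ℕ | δ (OrderDual.toDual j) ≠ 0}) ?_
    obtain ⟨j, hj⟩ := Finsupp.ne_iff.1 hδ0
    exact ⟨OrderDual.ofDual j, hj⟩
  have hP0 : coeff δ P ≠ 0 := fun h0 => by
    rw [(MonomialOrder.lex (σ := ℕᵒᵈ)).leadingCoeff_eq_zero_iff.1 h0] at hδ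
    exact hδ0 (by rw [hδ]; simp)
  have hsJ : OrderDual.toDual (scale n P) ∈ J := mem_supported_iff.1 hP δ hP0 _ hs
  rw [hdδ, hC0 δ hδ0, map_zero, add_zero]
  refine sum_mem fun j hj => ?_
  by_cases hjs : OrderDual.ofDual j ≤ scale n P
  · exact Submodule.smul_mem _ _ (Submodule.subset_span
      ⟨_, ⟨by have := (mem_varRange.1 hj).1; omega, hjs⟩, rfl⟩)
  set i := OrderDual.toDual (scale n P) with hi
  have hij : j < i := by
    have : scale n P < OrderDual.ofDual j := not_le.1 hjs
    exact this
  -- One factor `t_s` of the head monomial is replaced by `t_j` with `j > s`, which gives a higher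
  -- monomial. The equation at `ν` is a vanishing combination of the `t_l′`, so its `t_s′` term
  -- vanishes; that term involves the coefficient of `H` at `ν t_s = δ t_j`, the one defining `d_j`.
  set ν := δ - Finsupp.single i 1 + Finsupp.single j 1 with hν
  have hνi : ν + Finsupp.single i 1 = δ + Finsupp.single j 1 := by
    rw [hν, add_right_comm, tsub_add_cancel_of_le]
    rw [Finsupp.single_le_iff]
    omega
  have hδν : (MonomialOrder.lex (σ := ℕᵒᵈ)).toSyn δ < (MonomialOrder.lex (σ := ℕᵒᵈ)).toSyn ν := by
    refine lt_of_add_lt_add_right (a := (MonomialOrder.lex (σ := ℕᵒᵈ)).toSyn (Finsupp.single i 1)) ?_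
    rw [← map_add _ ν, hνi, map_add]
    exact add_lt_add_right (lex_single_lt_single hij) _
  obtain ⟨d', hd', hdν⟩ := hsmuls ν fun κ hκ => hHc κ (hδν.trans hκ)
  obtain ⟨c, hc⟩ := hHc ν hδν
  rw [hPlt ν hδν, hC0 ν (hne hδν), ← hc, h.deriv_const, map_zero, zero_add, add_zero] at hdν
  have hd0 := hd' i
  rw [h.eq_zero_of_sum_smul_deriv_eq_zero hdν.symm hsJ, hνi, map_zero, eq_comm, mul_eq_zero] at hd0
  have := hd j
  have hcz : CharZero K := charZero_of_injective_algebraMap (algebraMap C K).injective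
  rw [hd0.resolve_left (Nat.cast_add_one_ne_zero _), mul_zero, _root_.map_eq_zero] at this
  rw [this, zero_smul]
  exact zero_mem _

/-- The simple element `g` plays the role of a summand `p_n`, a constant polynomial over `K_n`. The
same descending step then removes `g, p_{n-1}, …, p_1` in turn and leaves the base step for `p_0`.
-/
lemma mem_logSpan_of_isFlatPoly (h : IsPrimitiveTower C n t) (hflat : IsFlatTower C n t)
    (hlog : ∀ i, 1 ≤ i → i ≤ n → (t i)′ ∈ logSpan C (tfield C t i : Set K))
    {g p v x : K} (hg : IsSimple (tfield C t n) (t n) g) (hp : IsFlatPoly C t n p)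
    (hx : x ∈ logSpan C (Set.univ : Set K)) (e : g + p = v′ + x) :
    g + p ∈ logSpan C (Set.univ : Set K) := by
  have htop : ∀ z : K, z ∈ tfield C t (n + 1) := fun z => by rw [h.top]; trivial
  have hx' : x ∈ logSpan C (tfield C t (n + 1) : Set K) := logSpan_mono (fun z _ => htop z) hx
  have hvn : v ∈ polyRing C t n n := (polyRing C t n n).algebraMap_mem ⟨v, htop v⟩
  cases n with
  | zero =>
    have hp : p = 0 := hp
    subst hp
    obtain ⟨_, _, _, η, ht⟩ := h.exists_differential le_rfl
    rw [← tfield_subset_iff] at hx'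
    have := (hermite_reduction ht hg (P := 0) (mem_adjoin_tfield_iff.2 (htop v)) hx'
      (by rw [map_zero]; exact e)).1
    rw [add_zero]
    exact logSpan_mono (Set.subset_univ _) this
  | succ m =>
    obtain ⟨P, hvars, rfl, hsimple, hrigid⟩ := hp
    have hsupp : ∀ i ≤ m, P i ∈ supported _ (varRange (i + 1) (m + 1) : Set ℕᵒᵈ) := fun i hi =>
      mem_supported.2 fun j hj => mem_varRange.2 (hvars i hi j hj)
    have hmem : ∀ i k, i ≤ k → k ≤ m → aeval (tpoint t) (P i) ∈ polyRing C t (m + 1) k :=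
      fun i k hik hk => aeval_mem_polyRing hik (hsupp i (by omega))
    have key : ∀ k ≤ m, ∀ w ∈ polyRing C t (m + 1) k,
        ∀ y ∈ logSpan C (tfield C t (k + 1) : Set K),
        ∑ i ∈ Finset.range (k + 1), aeval (tpoint t) (P i) = w′ + y →
        ∑ i ∈ Finset.range (k + 1), aeval (tpoint t) (P i) ∈ logSpan C (Set.univ : Set K) := by
      intro k
      induction k with
      | zero =>
        intro _ w hw y hy e
        rw [zero_add, Finset.sum_range_one] at e ⊢
        exact mem_logSpan_of_isFlatRigid h (by omega) hflat hlog (hsupp 0 (Nat.zero_le m)) hrigid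
          hw hy e
      | succ k ih =>
        intro hk w hw y hy e
        rw [Finset.sum_range_succ, add_comm] at e ⊢
        obtain ⟨h1, w', hw', y', hy', e'⟩ := mem_logSpan_of_isSimple_headCoeff h hflat
          (by omega) (hsupp (k + 1) hk) (hsimple (k + 1) (by omega) hk)
          (sum_mem fun i hi => hmem i k (by have := Finset.mem_range.1 hi; omega) (by omega)) hw hy e
        exact add_mem h1 (ih (by omega) w' hw' y' hy' e')
    have hgC : aeval (tpoint t) (MvPolynomial.C ⟨g, htop g⟩ :
      MvPolynomial ℕᵒᵈ (tfield C t (m + 1 + 1))) = g := by rw [aeval_C]; rfl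
    have e' := e
    rw [← hgC] at e'
    obtain ⟨h1, w, hw, y, hy, e''⟩ := mem_logSpan_of_isSimple_headCoeff h hflat le_rfl
      (P := MvPolynomial.C ⟨g, htop g⟩)
      ((supported _ _).algebraMap_mem _)
      (by rw [headCoeff, MonomialOrder.leadingCoeff_C]; exact hg)
      (sum_mem fun i hi => hmem i m (by have := Finset.mem_range.1 hi; omega) le_rfl) hvn hx' e'
    rw [hgC] at h1
    exact add_mem h1 (key m le_rfl w hw y hy e'')

end Flat

end DiffTower

theorem mainTheorem3 {C : Type*} {K : Type*} [Field C] [CharZero C] [IsAlgClosed C]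
    [Field K] [Differential K] [Algebra C K] (n : ℕ) (t : ℕ → K)
    (htower : DiffTower.IsPrimitiveTower C n t)
    (hlog : ∀ i, 1 ≤ i → i ≤ n →
      DiffTower.IsCombOfLogMonomials C (DiffTower.tfield C t i) (t i))
    (f g p : K)
    (hg : DiffTower.IsSimple (DiffTower.tfield C t n) (t n) g)
    (hp : (DiffTower.IsStraightTower C n t ∧ DiffTower.IsStraightPoly C t n p) ∨
      (DiffTower.IsFlatTower C n t ∧ DiffTower.IsFlatPoly C t n p))
    (hf : ∃ a : K, f = a′ + (g + p)) :
    DiffTower.IsElementarilyIntegrable f ↔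
      g + p ∈ Submodule.span C {x : K | DiffTower.IsLogDerivative x} := by
  have hC := htower.deriv_const
  have htop : ∀ x : K, x ∈ DiffTower.tfield C t (n + 1) := fun x => by rw [htower.top]; trivial
  have hlog' := fun i h1 hi =>
    DiffTower.IsCombOfLogMonomials.deriv_mem_logSpan hC (hlog i h1 hi)
  have hspan : Submodule.span C {x : K | DiffTower.IsLogDerivative x} =
      DiffTower.logSpan C Set.univ := by
    rw [DiffTower.logSpan]
    congr 1
    ext x
    simp [DiffTower.IsLogDerivative]
  obtain ⟨a, ha⟩ := hf
  rw [hspan]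
  constructor
  · intro h
    obtain ⟨v, x, hx, hv⟩ := DiffTower.liouville hC
      (fun x hx => htower.exists_eq_of_deriv_eq_zero le_rfl (htop x) hx) h
    have e : g + p = (v - a)′ + x := by
      rw [map_sub]
      linear_combination hv - ha
    rcases hp with ⟨-, hp⟩ | ⟨hflat, hp⟩
    · exact DiffTower.mem_logSpan_of_isStraightPoly htower hlog' le_rfl hg hp (htop _)
        (DiffTower.logSpan_mono (fun z _ => htop z) hx) e
    · exact DiffTower.mem_logSpan_of_isFlatPoly htower hflat hlog' hg hp hx e
  · exact fun h => DiffTower.isElementarilyIntegrable_of_mem_logSpan hC h ha
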